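/- Let $k$ be a field and let $A$ be a finite-dimensional Frobenius $k$-algebra, i.e. a finite-dimensional algebra with a linear form $\lambda : A \to k$ such that $(a,b)\mapsto \lambda(ab)$ is non-degenerate. Put $A^{\mathrm e}=A\otimes_k A^{\mathrm{op}}$; $A$-bimodules ($k$ acting centrally) are regarded as $A^{\mathrm e}$-modules. **Resolutions.** Let $\varepsilon:\mathbf P\to A$ be a projective resolution by finitely generated projective $A$-bimodules. Let $\mathbf T$ be a complete resolution of $A$: an exact complex, indexed by $\mathbb Z$, of finitely generated projective $A$-bimodules such that $\operatorname{Hom}_{A^{\mathrm e}}(\mathbf T,A^{\mathrm e})$ is exact, together with an augmentation $\varepsilon: T_0\to A$ which makes $\mathbf T_{\ge 0}$ a projective resolution of $A$. Let $\vartheta:\mathbf T\to\mathbf P$ be an augmentation-preserving chain map (for instance the canonical map onto the truncation $\mathbf P=\mathbf T_{\ge 0}$). For an $A$-bimodule $M$ and $n\in\mathbb Z$ put $$\mathrm H^n(A,M)=\mathrm H^n(\operatorname{Hom}_{A^{\mathrm e}}(\mathbf P,M)),\quad \mathrm H_n(A,M)=\mathrm H_n(\mathbf P\otimes_{A^{\mathrm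 e}}M),$$ $$\widehat{\mathrm H}^n(A,M)=\mathrm H^n(\operatorname{Hom}_{A^{\mathrm e}}(\mathbf T,M)),\quad \widehat{\mathrm H}_n(A,M)=\mathrm H_n(\mathbf T\otimes_{A^{\mathrm e}}M),$$ and let $\vartheta^*:\mathrm H^n(A,M)\to\widehat{\mathrm H}^n(A,M)$ and $\vartheta_*:\widehat{\mathrm H}_n(A,M)\to\mathrm H_n(A,M)$ be the maps induced by $\vartheta$. **Products.** For complexes $\mathbf C,\mathbf C'$ of bimodules let $\mathbf C\otimes_A\mathbf C'$ and $\mathbf C\,\widehat\otimes_A\mathbf C'$ be the tensor product and the complete tensor product, with $\bigoplus_{p+q=n}C_p\otimes_AC'_q$, respectively $\prod_{p+q=n}C_p\otimes_AC'_q$, in degree $n$, and differential $d(x\otimes y)=dx\otimes y+(-1)^{|x|}x\otimes dy$. Let $\Delta:\mathbf P\to\mathbf P\otimes_A\mathbf P$ and $\widehat\Delta:\mathbf T\to\mathbf T\,\widehat\otimes_A\mathbf T$ be diagonal approximations, i.e. chain maps of complexes of bimodules with $(\varepsilon\otimes\varepsilon)\Delta=\varepsilon$ and $(\varepsilon\,\widehat\otimes\,\varepsilon)\widehat\Delta=\varepsilon$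 in degree $0$, where $A\otimes_AA=A$. For $A$-bimodules $M,N$ the cup and cap products $$\smile:\mathrm H^r(A,M)\otimes\mathrm H^s(A,N)\to\mathrm H^{r+s}(A,M\otimes_AN),\qquad \frown:\mathrm H^r(A,M)\otimes\mathrm H_s(A,N)\to\mathrm H_{s-r}(A,M\otimes_AN)$$ are induced by $u\smile v=(u\otimes_Av)\Delta$, where $(u\otimes v)(x\otimes y)=(-1)^{|v||x|}u(x)\otimes v(y)$, and by applying to $(\Delta\otimes\mathrm{id}_N)(z)$ the map $(x\otimes y)\otimes n\mapsto(-1)^{|u||x|}\,x\otimes(u(y)\otimes n)$, where $u$ is zero on the components of other degrees. The products $\widehat\smile$ and $\widehat\frown$ on $\widehat{\mathrm H}$ are defined by the same formulas with $\mathbf T,\widehat\Delta$ in place of $\mathbf P,\Delta$. **Statement.** Let $M,N$ be $A$-bimodules. The map $\vartheta^*:\mathrm H^n(A,M)\to\widehat{\mathrm H}^n(A,M)$ is surjective for $n=0$ and bijective for $n>0$; for coefficients $N$ and $M\otimes_AN$ the map $\vartheta_*:\widehat{\mathrm H}_n\to\mathrm H_n$ is injective for $n=0$ (so that $\widehat{\mathrm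 H}_0\le\mathrm H_0$) and bijective for $n>0$ (so that $\widehat{\mathrm H}_n=\mathrm H_n$). Moreover: 1. For all $r,s\in\mathbb Z$, $u\in\mathrm H^r(A,M)$ and $v\in\mathrm H^s(A,N)$, $$\vartheta^*(u\smile v)=\vartheta^*u\;\widehat\smile\;\vartheta^*v\quad\text{in }\widehat{\mathrm H}^{r+s}(A,M\otimes_AN).$$ 2. The identity $$\vartheta_*\bigl(\vartheta^*u\;\widehat\frown\;z\bigr)=u\frown\vartheta_*z\quad\text{in }\mathrm H_{s-r}(A,M\otimes_AN),\qquad u\in\mathrm H^r(A,M),\ z\in\widehat{\mathrm H}_s(A,N),$$ holds in each of the following cases: (a) $r=s=0$; here, moreover, $u\frown\vartheta_*z$ lies in the subspace $\widehat{\mathrm H}_0(A,M\otimes_AN)\le\mathrm H_0(A,M\otimes_AN)$, so that $\frown$ restricts to a map $\mathrm H^0(A,M)\otimes\widehat{\mathrm H}_0(A,N)\to\widehat{\mathrm H}_0(A,M\otimes_AN)$, and this restriction is $\widehat\frown\circ(\vartheta^*\otimes\mathrm{id})$; (b) $r=0$ and $s>0$; (c) $s\ge r>0$. -/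

import Mathlib

open CategoryTheory
open scoped TensorProduct ModuleCat

set_option linter.unusedSectionVars false

noncomputable section

namespace TateHochschild

universe u u' v w w'

/-! ### Bimodules as modules over the enveloping algebra -/

/-- The enveloping algebra `A ⊗ Aᵒᵖ` of a `k`-algebra `A`. An `A`-bimodule (with `k` acting
centrally) is the same thing as a left module over it, `(a ⊗ b) • m = a m b`. -/
abbrev Env (k : Type u) (A : Type u') [Field k] [Ring A] [Algebra k A] : Type u' :=
  A ⊗[k] Aᵐᵒᵖ

variable {k : Type u} {A : Type u'} [Field k] [Ring A] [Algebra k A]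

instance envSemiring : Semiring (Env k A) := inferInstance
instance envRing : Ring (Env k A) := inferInstance
instance envAlgebra : Algebra k (Env k A) := inferInstance
instance envAddCommMonoid : AddCommMonoid (Env k A) := inferInstance
instance envAddCommGroup : AddCommGroup (Env k A) := inferInstance
instance envModule : Module k (Env k A) := inferInstance
instance envMonoid : Monoid (Env k A) := inferInstance
instance envSMul : SMul k (Env k A) := inferInstance

instance (priority := 2000) envActSMul {X : Type*} [AddCommGroup X] [Module (Env k A) X] :
    SMul (Env k A) X := inferInstance

instance (priority := 2000) envSMulCommClass {X : Type*} [AddCommGroup X] [Module k X]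
    [Module (Env k A) X] [IsScalarTower k (Env k A) X] : SMulCommClass (Env k A) k X := inferInstance

instance (priority := 2000) envCompatibleSMul {X Y : Type*} [AddCommGroup X] [Module k X]
    [Module (Env k A) X] [IsScalarTower k (Env k A) X] [AddCommGroup Y] [Module k Y]
    [Module (Env k A) Y] [IsScalarTower k (Env k A) Y] :
    LinearMap.CompatibleSMul X Y k (Env k A) := inferInstance

/-- The regular bimodule `A`. -/
def Regular (k : Type u) (A : Type u') [Field k] [Ring A] [Algebra k A] : Type u' := A

namespace Regular

instance : Ring (Regular k A) := inferInstanceAs (Ring A)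

instance : Algebra k (Regular k A) := inferInstanceAs (Algebra k A)

/-- The identification of `A` with the regular bimodule. -/
def of (k : Type u) {A : Type u'} [Field k] [Ring A] [Algebra k A] (a : A) : Regular k A := a

/-- The bimodule structure `(a ⊗ b) • x = a x b`. -/
instance : Module (Env k A) (Regular k A) := instModuleTensorProductMop k A

theorem smul_eq (a : A) (b : Aᵐᵒᵖ) (x : Regular k A) :
    (a ⊗ₜ[k] b : Env k A) • x = of k a * x * of k b.unop :=
  AlgHom.mulLeftRight_apply k A a b x

instance : IsScalarTower k (Env k A) (Regular k A) where
  smul_assoc c e x :=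
    congrArg (fun f : Module.End k A => f x) (map_smul (AlgHom.mulLeftRight k A) c e)

end Regular

/-- A finite dimensional algebra is Frobenius if it carries a nondegenerate bilinear form with
`⟨a b, c⟩ = ⟨a, b c⟩`. -/
def IsFrobenius (k : Type u) (A : Type u') [Field k] [Ring A] [Algebra k A] : Prop :=
  FiniteDimensional k A ∧
    ∃ B : A →ₗ[k] A →ₗ[k] k, B.Nondegenerate ∧ ∀ a b c : A, B (a * b) c = B a (b * c)

section Tensor

variable {X : Type*} [AddCommGroup X] [Module k X] [Module (Env k A) X]
  [IsScalarTower k (Env k A) X]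
variable {Y : Type*} [AddCommGroup Y] [Module k Y] [Module (Env k A) Y]
  [IsScalarTower k (Env k A) Y]
variable {X₁ : Type*} [AddCommGroup X₁] [Module k X₁] [Module (Env k A) X₁]
  [IsScalarTower k (Env k A) X₁]
variable {Y₁ : Type*} [AddCommGroup Y₁] [Module k Y₁] [Module (Env k A) Y₁]
  [IsScalarTower k (Env k A) Y₁]

/-- The left action `a x` of `A` on a bimodule, as an algebra map into the endomorphisms. -/
def leftAct (k : Type u) (A : Type u') [Field k] [Ring A] [Algebra k A]
    (X : Type*) [AddCommGroup X] [Module k X] [Module (Env k A) X]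
    [IsScalarTower k (Env k A) X] : A →ₐ[k] Module.End k X :=
  (Algebra.lsmul k k X (A := Env k A)).comp Algebra.TensorProduct.includeLeft

/-- The right action `x a` of `A` on a bimodule, as an algebra map from `Aᵒᵖ`. -/
def rightAct (k : Type u) (A : Type u') [Field k] [Ring A] [Algebra k A]
    (X : Type*) [AddCommGroup X] [Module k X] [Module (Env k A) X]
    [IsScalarTower k (Env k A) X] : Aᵐᵒᵖ →ₐ[k] Module.End k X :=
  (Algebra.lsmul k k X (A := Env k A)).comp Algebra.TensorProduct.includeRight

theorem leftAct_apply (a : A) (x : X) :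
    leftAct k A X a x = (a ⊗ₜ[k] (1 : Aᵐᵒᵖ) : Env k A) • x := rfl

theorem rightAct_apply (a : Aᵐᵒᵖ) (x : X) :
    rightAct k A X a x = ((1 : A) ⊗ₜ[k] a : Env k A) • x := rfl

variable (k A) in
/-- The relations `x a ⊗ y = x ⊗ a y`. -/
def balancedRel (X Y : Type*) [AddCommGroup X] [Module k X] [Module (Env k A) X]
    [IsScalarTower k (Env k A) X] [AddCommGroup Y] [Module k Y] [Module (Env k A) Y]
    [IsScalarTower k (Env k A) Y] : Submodule k (X ⊗[k] Y) :=
  Submodule.span k {t | ∃ (x : X) (a : A) (y : Y),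
    t = (rightAct k A X (MulOpposite.op a) x) ⊗ₜ[k] y - x ⊗ₜ[k] (leftAct k A Y a y)}

variable (k A) in
/-- The tensor product `X ⊗_A Y` of two `A`-bimodules. -/
def TensorA (X Y : Type*) [AddCommGroup X] [Module k X] [Module (Env k A) X]
    [IsScalarTower k (Env k A) X] [AddCommGroup Y] [Module k Y] [Module (Env k A) Y]
    [IsScalarTower k (Env k A) Y] :=
  (X ⊗[k] Y) ⧸ balancedRel k A X Y

namespace TensorA

instance : AddCommGroup (TensorA k A X Y) :=
  Submodule.Quotient.addCommGroup (balancedRel k A X Y)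

instance : Module k (TensorA k A X Y) :=
  Submodule.Quotient.module (balancedRel k A X Y)

variable (k A X Y) in
/-- The quotient map `X ⊗_k Y → X ⊗_A Y`. -/
def proj : X ⊗[k] Y →ₗ[k] TensorA k A X Y := (balancedRel k A X Y).mkQ

variable (k A) in
/-- The class `x ⊗_A y`. -/
def mk (x : X) (y : Y) : TensorA k A X Y := proj k A X Y (x ⊗ₜ[k] y)

theorem proj_surjective : Function.Surjective (proj k A X Y) :=
  (balancedRel k A X Y).mkQ_surjective

theorem mk_balanced (x : X) (a : A) (y : Y) :
    mk k A (((1 : A) ⊗ₜ[k] MulOpposite.op a : Env k A) • x) y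
      = mk k A x ((a ⊗ₜ[k] (1 : Aᵐᵒᵖ) : Env k A) • y) := by
  refine (Submodule.Quotient.eq _).2 (Submodule.subset_span ⟨x, a, y, rfl⟩)

variable (k A X Y) in
/-- The bimodule structure on `X ⊗_k Y`: outer left action on `X`, outer right action on `Y`. -/
def outerAct : Env k A →ₐ[k] Module.End k (X ⊗[k] Y) :=
  (Module.endTensorEndAlgHom (R := k) (S := k) (A := k) (M := X) (N := Y)).comp
    (Algebra.TensorProduct.map (leftAct k A X) (rightAct k A Y))

theorem outerAct_tmul (a : A) (b : Aᵐᵒᵖ) (x : X) (y : Y) :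
    outerAct k A X Y (a ⊗ₜ[k] b) (x ⊗ₜ[k] y)
      = (leftAct k A X a x) ⊗ₜ[k] (rightAct k A Y b y) := rfl

theorem left_right_comm (a : A) (b : Aᵐᵒᵖ) (x : X) :
    leftAct k A X a (rightAct k A X b x) = rightAct k A X b (leftAct k A X a x) := by
  simp only [leftAct_apply, rightAct_apply, ← mul_smul, Algebra.TensorProduct.tmul_mul_tmul,
    one_mul, mul_one]

theorem outerAct_stable (e : Env k A) :
    balancedRel k A X Y ≤ (balancedRel k A X Y).comap (outerAct k A X Y e) := by
  induction e using TensorProduct.induction_on with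
  | zero => intro t _; simp
  | add e f he hf =>
    intro t ht
    simp only [Submodule.mem_comap, map_add, LinearMap.add_apply]
    exact Submodule.add_mem _ (he ht) (hf ht)
  | tmul a b =>
    refine Submodule.span_le.2 ?_
    rintro _ ⟨x, c, y, rfl⟩
    refine Submodule.subset_span ⟨leftAct k A X a x, c, rightAct k A Y b y, ?_⟩
    rw [map_sub, outerAct_tmul, outerAct_tmul, left_right_comm, left_right_comm]

instance : SMul (Env k A) (TensorA k A X Y) where
  smul e := (balancedRel k A X Y).mapQ (balancedRel k A X Y) (outerAct k A X Y e)
    (outerAct_stable e)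

theorem smul_proj (e : Env k A) (t : X ⊗[k] Y) :
    e • proj k A X Y t = proj k A X Y (outerAct k A X Y e t) := rfl

/-- The bimodule structure `a (x ⊗ y) b = a x ⊗ y b` on `X ⊗_A Y`. -/
instance : Module (Env k A) (TensorA k A X Y) where
  one_smul t := by
    obtain ⟨t, rfl⟩ := proj_surjective t
    rw [smul_proj, map_one, Module.End.one_apply]
  mul_smul e f t := by
    obtain ⟨t, rfl⟩ := proj_surjective t
    simp only [smul_proj, map_mul, Module.End.mul_apply]
  smul_zero e := by
    rw [← map_zero (proj k A X Y), smul_proj, map_zero]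
  zero_smul t := by
    obtain ⟨t, rfl⟩ := proj_surjective t
    rw [smul_proj, map_zero, LinearMap.zero_apply, map_zero]
  smul_add e s t := by
    obtain ⟨s, rfl⟩ := proj_surjective s
    obtain ⟨t, rfl⟩ := proj_surjective t
    simp only [← map_add, smul_proj]
  add_smul e f t := by
    obtain ⟨t, rfl⟩ := proj_surjective t
    simp only [smul_proj, map_add, LinearMap.add_apply]

instance : IsScalarTower k (Env k A) (TensorA k A X Y) where
  smul_assoc c e t := by
    obtain ⟨t, rfl⟩ := proj_surjective t
    rw [smul_proj, smul_proj, map_smul, LinearMap.smul_apply, map_smul]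

theorem smul_mk (a : A) (b : Aᵐᵒᵖ) (x : X) (y : Y) :
    (a ⊗ₜ[k] b : Env k A) • mk k A x y
      = mk k A ((a ⊗ₜ[k] (1 : Aᵐᵒᵖ) : Env k A) • x) (((1 : A) ⊗ₜ[k] b : Env k A) • y) := rfl

theorem induction_on {p : TensorA k A X Y → Prop} (t : TensorA k A X Y) (zero : p 0)
    (mk : ∀ x y, p (mk k A x y)) (add : ∀ s t, p s → p t → p (s + t)) : p t := by
  obtain ⟨t, rfl⟩ := proj_surjective t
  induction t using TensorProduct.induction_on with
  | zero => simpa using zero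
  | tmul x y => exact mk x y
  | add s t hs ht => rw [map_add]; exact add _ _ hs ht

/-- The `k`-linear map out of `X ⊗_A Y` induced by a balanced bilinear map. -/
def lift {Z : Type*} [AddCommGroup Z] [Module k Z] (f : X →ₗ[k] Y →ₗ[k] Z)
    (hf : ∀ (x : X) (a : A) (y : Y), f (((1 : A) ⊗ₜ[k] MulOpposite.op a : Env k A) • x) y
      = f x ((a ⊗ₜ[k] (1 : Aᵐᵒᵖ) : Env k A) • y)) : TensorA k A X Y →ₗ[k] Z :=
  (balancedRel k A X Y).liftQ (TensorProduct.lift f) (by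
    refine Submodule.span_le.2 ?_
    rintro _ ⟨x, a, y, rfl⟩
    simp only [SetLike.mem_coe, LinearMap.mem_ker, map_sub, TensorProduct.lift.tmul, sub_eq_zero]
    exact hf x a y)

theorem lift_mk {Z : Type*} [AddCommGroup Z] [Module k Z] (f : X →ₗ[k] Y →ₗ[k] Z)
    (hf : ∀ (x : X) (a : A) (y : Y), f (((1 : A) ⊗ₜ[k] MulOpposite.op a : Env k A) • x) y
      = f x ((a ⊗ₜ[k] (1 : Aᵐᵒᵖ) : Env k A) • y)) (x : X) (y : Y) :
    lift f hf (mk k A x y) = f x y := rfl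

theorem mk_add_left (x x' : X) (y : Y) : mk k A (x + x') y = mk k A x y + mk k A x' y := by
  simp only [mk, TensorProduct.add_tmul, map_add]

theorem mk_add_right (x : X) (y y' : Y) : mk k A x (y + y') = mk k A x y + mk k A x y' := by
  simp only [mk, TensorProduct.tmul_add, map_add]

theorem mk_smul_left (c : k) (x : X) (y : Y) : mk k A (c • x) y = c • mk k A x y := by
  simp only [mk, ← TensorProduct.smul_tmul', map_smul]

theorem mk_smul_right (c : k) (x : X) (y : Y) : mk k A x (c • y) = c • mk k A x y := by
  simp only [mk, TensorProduct.tmul_smul, map_smul]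

/-- A `k`-linear map out of `X ⊗_A Y` that commutes with the bimodule action on generators. -/
theorem map_env_smul {Z : Type*} [AddCommGroup Z] [Module k Z] [Module (Env k A) Z]
    (g : TensorA k A X Y →ₗ[k] Z)
    (hg : ∀ (a : A) (b : Aᵐᵒᵖ) (x : X) (y : Y),
      g ((a ⊗ₜ[k] b : Env k A) • mk k A x y) = (a ⊗ₜ[k] b : Env k A) • g (mk k A x y))
    (e : Env k A) (t : TensorA k A X Y) : g (e • t) = e • g t := by
  induction e using TensorProduct.induction_on with
  | zero =>
    exact (congrArg g (zero_smul (Env k A) t)).trans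
      ((map_zero g).trans (zero_smul (Env k A) (g t)).symm)
  | add e f he hf => simp only [add_smul, map_add, he, hf]
  | tmul a b =>
    induction t using induction_on with
    | zero => simp
    | mk x y => exact hg a b x y
    | add s t hs ht => simp only [smul_add, map_add, hs, ht]

/-- The bimodule map `f ⊗_A g`. -/
def map (f : X →ₗ[Env k A] X₁) (g : Y →ₗ[Env k A] Y₁) :
    TensorA k A X Y →ₗ[Env k A] TensorA k A X₁ Y₁ :=
  let h : TensorA k A X Y →ₗ[k] TensorA k A X₁ Y₁ :=
    lift (LinearMap.mk₂ k (fun x y => mk k A (f x) (g y))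
      (fun x x' y => by rw [map_add, mk_add_left])
      (fun c x y => by rw [LinearMap.map_smul_of_tower, mk_smul_left])
      (fun x y y' => by rw [map_add, mk_add_right])
      (fun c x y => by rw [LinearMap.map_smul_of_tower, mk_smul_right]))
      (fun x a y => by
        simp only [LinearMap.mk₂_apply, map_smul]
        exact mk_balanced _ _ _)
  { toFun := h
    map_add' := h.map_add
    map_smul' := fun e t => by
      refine map_env_smul h (fun a b x y => ?_) e t
      have h₁ : ∀ x y, h (mk k A x y) = mk k A (f x) (g y) := fun _ _ => rfl
      rw [smul_mk, h₁, h₁, smul_mk, map_smul, map_smul] }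

theorem map_mk (f : X →ₗ[Env k A] X₁) (g : Y →ₗ[Env k A] Y₁) (x : X) (y : Y) :
    map f g (mk k A x y) = mk k A (f x) (g y) := rfl

theorem map_add_left (f f' : X →ₗ[Env k A] X₁) (g : Y →ₗ[Env k A] Y₁) (t : TensorA k A X Y) :
    map (f + f') g t = map f g t + map f' g t := by
  induction t using induction_on with
  | zero => simp only [map_zero, add_zero]
  | mk x y => simp only [map_mk, LinearMap.add_apply, mk_add_left]
  | add s t hs ht => rw [_root_.map_add, hs, ht, _root_.map_add, _root_.map_add]; abel

theorem map_add_right (f : X →ₗ[Env k A] X₁) (g g' : Y →ₗ[Env k A] Y₁) (t : TensorA k A X Y) :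
    map f (g + g') t = map f g t + map f g' t := by
  induction t using induction_on with
  | zero => simp only [map_zero, add_zero]
  | mk x y => simp only [map_mk, LinearMap.add_apply, mk_add_right]
  | add s t hs ht => rw [_root_.map_add, hs, ht, _root_.map_add, _root_.map_add]; abel

theorem map_smul_left (c : k) (f : X →ₗ[Env k A] X₁) (g : Y →ₗ[Env k A] Y₁)
    (t : TensorA k A X Y) : map (c • f) g t = c • map f g t := by
  induction t using induction_on with
  | zero => simp only [map_zero, smul_zero]
  | mk x y => simp only [map_mk, LinearMap.smul_apply, mk_smul_left]
  | add s t hs ht => rw [_root_.map_add, hs, ht, _root_.map_add, smul_add]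

theorem map_smul_right (c : k) (f : X →ₗ[Env k A] X₁) (g : Y →ₗ[Env k A] Y₁)
    (t : TensorA k A X Y) : map f (c • g) t = c • map f g t := by
  induction t using induction_on with
  | zero => simp only [map_zero, smul_zero]
  | mk x y => simp only [map_mk, LinearMap.smul_apply, mk_smul_right]
  | add s t hs ht => rw [_root_.map_add, hs, ht, _root_.map_add, smul_add]

theorem map_map {X₂ : Type*} [AddCommGroup X₂] [Module k X₂] [Module (Env k A) X₂]
    [IsScalarTower k (Env k A) X₂] {Y₂ : Type*} [AddCommGroup Y₂] [Module k Y₂]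
    [Module (Env k A) Y₂] [IsScalarTower k (Env k A) Y₂]
    (f : X →ₗ[Env k A] X₁) (g : Y →ₗ[Env k A] Y₁) (f' : X₁ →ₗ[Env k A] X₂)
    (g' : Y₁ →ₗ[Env k A] Y₂) (t : TensorA k A X Y) :
    map f' g' (map f g t) = map (f' ∘ₗ f) (g' ∘ₗ g) t := by
  induction t using induction_on with
  | zero => simp only [map_zero]
  | mk x y => simp only [map_mk, LinearMap.comp_apply]
  | add s t hs ht => simp only [_root_.map_add, hs, ht]

theorem map_zero_left (g : Y →ₗ[Env k A] Y₁) (t : TensorA k A X Y) :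
    map (0 : X →ₗ[Env k A] X₁) g t = 0 := by
  have h := map_smul_left (0 : k) (0 : X →ₗ[Env k A] X₁) g t
  rwa [smul_zero, zero_smul] at h

theorem map_zero_right (f : X →ₗ[Env k A] X₁) (t : TensorA k A X Y) :
    map f (0 : Y →ₗ[Env k A] Y₁) t = 0 := by
  have h := map_smul_right (0 : k) f (0 : Y →ₗ[Env k A] Y₁) t
  rwa [smul_zero, zero_smul] at h

theorem hom_ext {Z : Type*} [AddCommGroup Z] [Module (Env k A) Z]
    {f g : TensorA k A X Y →ₗ[Env k A] Z} (h : ∀ x y, f (mk k A x y) = g (mk k A x y)) :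
    f = g := by
  ext t
  induction t using induction_on with
  | zero => simp
  | mk x y => exact h x y
  | add s t hs ht => simp only [map_add, hs, ht]

end TensorA

variable (k A) in
/-- The relations `x (a ⊗ b) ⊗ m = x ⊗ (a ⊗ b) m`, where the bimodule `X` is regarded as a right
module over the enveloping algebra by `x (a ⊗ b) = b x a`, and `M` as a left module. -/
def envRel (X M : Type*) [AddCommGroup X] [Module k X] [Module (Env k A) X]
    [AddCommGroup M] [Module k M] [Module (Env k A) M] : Submodule k (X ⊗[k] M) :=
  Submodule.span k {t | ∃ (x : X) (a b : A) (m : M),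
    t = ((b ⊗ₜ[k] MulOpposite.op a : Env k A) • x) ⊗ₜ[k] m
      - x ⊗ₜ[k] ((a ⊗ₜ[k] MulOpposite.op b : Env k A) • m)}

variable (k A) in
/-- The tensor product `X ⊗_{A ⊗ Aᵒᵖ} M` of two bimodules, a `k`-vector space. -/
def TensorEnv (X M : Type*) [AddCommGroup X] [Module k X] [Module (Env k A) X]
    [AddCommGroup M] [Module k M] [Module (Env k A) M] :=
  (X ⊗[k] M) ⧸ envRel k A X M

namespace TensorEnv

instance : AddCommGroup (TensorEnv k A X Y) :=
  Submodule.Quotient.addCommGroup (envRel k A X Y)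

instance : Module k (TensorEnv k A X Y) :=
  Submodule.Quotient.module (envRel k A X Y)

variable (k A X Y) in
/-- The quotient map `X ⊗_k M → X ⊗_{A ⊗ Aᵒᵖ} M`. -/
def proj : X ⊗[k] Y →ₗ[k] TensorEnv k A X Y := (envRel k A X Y).mkQ

variable (k A) in
/-- The class of `x ⊗ m`. -/
def mk (x : X) (y : Y) : TensorEnv k A X Y := proj k A X Y (x ⊗ₜ[k] y)

theorem proj_surjective : Function.Surjective (proj k A X Y) :=
  (envRel k A X Y).mkQ_surjective

theorem mk_balanced (x : X) (a b : A) (y : Y) :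
    mk k A ((b ⊗ₜ[k] MulOpposite.op a : Env k A) • x) y
      = mk k A x ((a ⊗ₜ[k] MulOpposite.op b : Env k A) • y) := by
  refine (Submodule.Quotient.eq _).2 (Submodule.subset_span ⟨x, a, b, y, rfl⟩)

theorem induction_on {p : TensorEnv k A X Y → Prop} (t : TensorEnv k A X Y) (zero : p 0)
    (mk : ∀ x y, p (mk k A x y)) (add : ∀ s t, p s → p t → p (s + t)) : p t := by
  obtain ⟨t, rfl⟩ := proj_surjective t
  induction t using TensorProduct.induction_on with
  | zero => simpa using zero
  | tmul x y => exact mk x y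
  | add s t hs ht => rw [map_add]; exact add _ _ hs ht

/-- The `k`-linear map out of `X ⊗_{A ⊗ Aᵒᵖ} M` induced by a balanced bilinear map. -/
def lift {Z : Type*} [AddCommGroup Z] [Module k Z] (f : X →ₗ[k] Y →ₗ[k] Z)
    (hf : ∀ (x : X) (a b : A) (y : Y), f ((b ⊗ₜ[k] MulOpposite.op a : Env k A) • x) y
      = f x ((a ⊗ₜ[k] MulOpposite.op b : Env k A) • y)) : TensorEnv k A X Y →ₗ[k] Z :=
  (envRel k A X Y).liftQ (TensorProduct.lift f) (by
    refine Submodule.span_le.2 ?_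
    rintro _ ⟨x, a, b, y, rfl⟩
    simp only [SetLike.mem_coe, LinearMap.mem_ker, map_sub, TensorProduct.lift.tmul, sub_eq_zero]
    exact hf x a b y)

theorem lift_mk {Z : Type*} [AddCommGroup Z] [Module k Z] (f : X →ₗ[k] Y →ₗ[k] Z)
    (hf : ∀ (x : X) (a b : A) (y : Y), f ((b ⊗ₜ[k] MulOpposite.op a : Env k A) • x) y
      = f x ((a ⊗ₜ[k] MulOpposite.op b : Env k A) • y)) (x : X) (y : Y) :
    lift f hf (mk k A x y) = f x y := rfl

theorem mk_add_left (x x' : X) (y : Y) : mk k A (x + x') y = mk k A x y + mk k A x' y := by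
  simp only [mk, TensorProduct.add_tmul, map_add]

theorem mk_add_right (x : X) (y y' : Y) : mk k A x (y + y') = mk k A x y + mk k A x y' := by
  simp only [mk, TensorProduct.tmul_add, map_add]

theorem mk_smul_left (c : k) (x : X) (y : Y) : mk k A (c • x) y = c • mk k A x y := by
  simp only [mk, ← TensorProduct.smul_tmul', map_smul]

theorem mk_smul_right (c : k) (x : X) (y : Y) : mk k A x (c • y) = c • mk k A x y := by
  simp only [mk, TensorProduct.tmul_smul, map_smul]

/-- The map `f ⊗ id` on `X ⊗_{A ⊗ Aᵒᵖ} M`. -/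
def mapLeft (M : Type*) [AddCommGroup M] [Module k M] [Module (Env k A) M]
    [IsScalarTower k (Env k A) M] (f : X →ₗ[Env k A] X₁) :
    TensorEnv k A X M →ₗ[k] TensorEnv k A X₁ M :=
  lift (LinearMap.mk₂ k (fun x y => mk k A (f x) y)
      (fun x x' y => by rw [map_add, mk_add_left])
      (fun c x y => by rw [LinearMap.map_smul_of_tower, mk_smul_left])
      (fun x y y' => by rw [mk_add_right])
      (fun c x y => by rw [mk_smul_right]))
    (fun x a b y => by
      simp only [LinearMap.mk₂_apply, map_smul]
      exact mk_balanced _ _ _ _)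

theorem mapLeft_mk {M : Type*} [AddCommGroup M] [Module k M] [Module (Env k A) M]
    [IsScalarTower k (Env k A) M] (f : X →ₗ[Env k A] X₁) (x : X) (m : M) :
    mapLeft M f (mk k A x m) = mk k A (f x) m := rfl

theorem hom_ext {Z : Type*} [AddCommGroup Z] [Module k Z]
    {f g : TensorEnv k A X Y →ₗ[k] Z} (h : ∀ x y, f (mk k A x y) = g (mk k A x y)) :
    f = g := by
  ext t
  induction t using induction_on with
  | zero => simp
  | mk x y => exact h x y
  | add s t hs ht => simp only [map_add, hs, ht]

end TensorEnv

variable (X) in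
/-- Auxiliary: `(x, y) ↦ (n ↦ x ⊗ (u y ⊗ n))` as a bilinear map. -/
def contractAux (N : Type*) [AddCommGroup N] [Module k N] [Module (Env k A) N]
    [IsScalarTower k (Env k A) N] (u : Y →ₗ[Env k A] Y₁) :
    X →ₗ[k] Y →ₗ[k] N →ₗ[k] TensorEnv k A X (TensorA k A Y₁ N) :=
  LinearMap.mk₂ k
    (fun x y =>
      ({ toFun := fun n => TensorEnv.mk k A x (TensorA.mk k A (u y) n)
         map_add' := fun n n' => by rw [TensorA.mk_add_right, TensorEnv.mk_add_right]
         map_smul' := fun c n => by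
           rw [TensorA.mk_smul_right, TensorEnv.mk_smul_right, RingHom.id_apply] } :
        N →ₗ[k] TensorEnv k A X (TensorA k A Y₁ N)))
    (fun x x' y => LinearMap.ext fun n => TensorEnv.mk_add_left _ _ _)
    (fun c x y => LinearMap.ext fun n => TensorEnv.mk_smul_left _ _ _)
    (fun x y y' => LinearMap.ext fun n => by
      simp only [LinearMap.coe_mk, AddHom.coe_mk, LinearMap.add_apply, map_add,
        TensorA.mk_add_left, TensorEnv.mk_add_right])
    (fun c x y => LinearMap.ext fun n => by
      simp only [LinearMap.coe_mk, AddHom.coe_mk, LinearMap.smul_apply,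
        LinearMap.map_smul_of_tower, TensorA.mk_smul_left, TensorEnv.mk_smul_right])

theorem contractAux_apply (N : Type*) [AddCommGroup N] [Module k N] [Module (Env k A) N]
    [IsScalarTower k (Env k A) N] (u : Y →ₗ[Env k A] Y₁) (x : X) (y : Y) (n : N) :
    contractAux X N u x y n = TensorEnv.mk k A x (TensorA.mk k A (u y) n) := rfl

theorem contractAux_balanced (N : Type*) [AddCommGroup N] [Module k N] [Module (Env k A) N]
    [IsScalarTower k (Env k A) N] (u : Y →ₗ[Env k A] Y₁) (x : X) (a : A) (y : Y) :
    contractAux X N u (((1 : A) ⊗ₜ[k] MulOpposite.op a : Env k A) • x) y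
      = contractAux X N u x ((a ⊗ₜ[k] (1 : Aᵐᵒᵖ) : Env k A) • y) := by
  refine LinearMap.ext fun n => ?_
  have h := TensorEnv.mk_balanced (k := k) (A := A) x a 1 (TensorA.mk k A (u y) n)
  rw [contractAux_apply, contractAux_apply, map_smul, h, TensorA.smul_mk, MulOpposite.op_one,
    ← Algebra.TensorProduct.one_def, one_smul]

theorem contractAux_env (N : Type*) [AddCommGroup N] [Module k N] [Module (Env k A) N]
    [IsScalarTower k (Env k A) N] (u : Y →ₗ[Env k A] Y₁) (t : TensorA k A X Y) (a b : A) (n : N) :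
    TensorA.lift (contractAux X N u) (contractAux_balanced N u)
        ((b ⊗ₜ[k] MulOpposite.op a : Env k A) • t) n
      = TensorA.lift (contractAux X N u) (contractAux_balanced N u) t
        ((a ⊗ₜ[k] MulOpposite.op b : Env k A) • n) := by
  induction t using TensorA.induction_on with
  | zero => rw [smul_zero, map_zero, LinearMap.zero_apply, LinearMap.zero_apply]
  | add s t hs ht => simp only [smul_add, map_add, LinearMap.add_apply, hs, ht]
  | mk x y =>
    have h := TensorEnv.mk_balanced (k := k) (A := A) x 1 b
      (TensorA.mk k A (u (((1 : A) ⊗ₜ[k] MulOpposite.op a : Env k A) • y)) n)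
    rw [MulOpposite.op_one] at h
    rw [TensorA.smul_mk, TensorA.lift_mk, TensorA.lift_mk, contractAux_apply, contractAux_apply,
      h, TensorA.smul_mk, ← Algebra.TensorProduct.one_def, one_smul, map_smul,
      TensorA.mk_balanced, ← mul_smul, Algebra.TensorProduct.tmul_mul_tmul, mul_one, one_mul]

variable (X) in
/-- For a bimodule map `u : Y → M`, the map
`(X ⊗_A Y) ⊗_{A ⊗ Aᵒᵖ} N → X ⊗_{A ⊗ Aᵒᵖ} (M ⊗_A N)`, `(x ⊗ y) ⊗ n ↦ x ⊗ (u y ⊗ n)`. -/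
def contract (N : Type*) [AddCommGroup N] [Module k N] [Module (Env k A) N]
    [IsScalarTower k (Env k A) N] (u : Y →ₗ[Env k A] Y₁) :
    TensorEnv k A (TensorA k A X Y) N →ₗ[k] TensorEnv k A X (TensorA k A Y₁ N) :=
  TensorEnv.lift (TensorA.lift (contractAux X N u) (contractAux_balanced N u))
    (contractAux_env N u)

theorem contract_mk (N : Type*) [AddCommGroup N] [Module k N] [Module (Env k A) N]
    [IsScalarTower k (Env k A) N] (u : Y →ₗ[Env k A] Y₁) (x : X) (y : Y) (n : N) :
    contract X N u (TensorEnv.mk k A (TensorA.mk k A x y) n)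
      = TensorEnv.mk k A x (TensorA.mk k A (u y) n) := rfl

/-- The map `X ⊗_A Y → A`, `x ⊗ y ↦ ε x * ε' y`: the tensor product `ε ⊗_A ε'` followed by the
identification `A ⊗_A A = A`. -/
def augTensor (ε : X →ₗ[Env k A] Regular k A) (ε' : Y →ₗ[Env k A] Regular k A) :
    TensorA k A X Y →ₗ[k] Regular k A :=
  TensorA.lift (LinearMap.mk₂ k (fun x y => ε x * ε' y)
      (fun x x' y => by rw [map_add, add_mul])
      (fun c x y => by rw [LinearMap.map_smul_of_tower, smul_mul_assoc])
      (fun x y y' => by rw [map_add, mul_add])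
      (fun c x y => by rw [LinearMap.map_smul_of_tower, mul_smul_comm]))
    (fun x a y => by
      have h : Regular.of k (1 : A) = 1 := rfl
      simp only [LinearMap.mk₂_apply, map_smul, Regular.smul_eq, MulOpposite.unop_op,
        MulOpposite.unop_one, h, one_mul, mul_one, mul_assoc])

end Tensor

section Linear

variable {X : Type*} [AddCommGroup X] [Module k X] [Module (Env k A) X]
  [IsScalarTower k (Env k A) X]
variable {Y : Type*} [AddCommGroup Y] [Module k Y] [Module (Env k A) Y]
  [IsScalarTower k (Env k A) Y]
variable {X₁ : Type*} [AddCommGroup X₁] [Module k X₁] [Module (Env k A) X₁]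
  [IsScalarTower k (Env k A) X₁]
variable {Y₁ : Type*} [AddCommGroup Y₁] [Module k Y₁] [Module (Env k A) Y₁]
  [IsScalarTower k (Env k A) Y₁]
variable {M : Type*} [AddCommGroup M] [Module k M] [Module (Env k A) M]
  [IsScalarTower k (Env k A) M]
variable {N : Type*} [AddCommGroup N] [Module k N] [Module (Env k A) N]
  [IsScalarTower k (Env k A) N]

theorem contract_induction {p : TensorEnv k A (TensorA k A X Y) N → Prop}
    (t : TensorEnv k A (TensorA k A X Y) N) (zero : p 0)
    (mk : ∀ x y n, p (TensorEnv.mk k A (TensorA.mk k A x y) n))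
    (add : ∀ s t, p s → p t → p (s + t)) : p t := by
  induction t using TensorEnv.induction_on with
  | zero => exact zero
  | add s t hs ht => exact add s t hs ht
  | mk w n =>
    induction w using TensorA.induction_on with
    | zero =>
      have h : TensorEnv.mk k A (0 : TensorA k A X Y) n = 0 := by
        rw [TensorEnv.mk, TensorProduct.zero_tmul, map_zero]
      rw [h]; exact zero
    | mk x y => exact mk x y n
    | add s t hs ht => rw [TensorEnv.mk_add_left]; exact add _ _ hs ht

theorem contract_add (u u' : Y →ₗ[Env k A] M) (t : TensorEnv k A (TensorA k A X Y) N) :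
    contract X N (u + u') t = contract X N u t + contract X N u' t := by
  induction t using contract_induction with
  | zero => simp only [map_zero, add_zero]
  | add s t hs ht => rw [map_add, hs, ht, map_add, map_add]; abel
  | mk x y n =>
    rw [contract_mk, contract_mk, contract_mk, LinearMap.add_apply, TensorA.mk_add_left,
      TensorEnv.mk_add_right]

theorem contract_smul (c : k) (u : Y →ₗ[Env k A] M) (t : TensorEnv k A (TensorA k A X Y) N) :
    contract X N (c • u) t = c • contract X N u t := by
  induction t using contract_induction with
  | zero => simp only [map_zero, smul_zero]
  | add s t hs ht => rw [map_add, hs, ht, map_add, smul_add]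
  | mk x y n =>
    rw [contract_mk, contract_mk, LinearMap.smul_apply, TensorA.mk_smul_left,
      TensorEnv.mk_smul_right]

theorem contract_zero (t : TensorEnv k A (TensorA k A X Y) N) :
    contract X N (0 : Y →ₗ[Env k A] M) t = 0 := by
  have h := contract_smul (0 : k) (0 : Y →ₗ[Env k A] M) t
  rwa [smul_zero, zero_smul] at h

theorem contract_mapLeft (f : X →ₗ[Env k A] X₁) (g : Y →ₗ[Env k A] Y₁) (u : Y₁ →ₗ[Env k A] M)
    (t : TensorEnv k A (TensorA k A X Y) N) :
    contract X₁ N u (TensorEnv.mapLeft N (TensorA.map f g) t)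
      = TensorEnv.mapLeft (TensorA k A M N) f (contract X N (u ∘ₗ g) t) := by
  induction t using contract_induction with
  | zero => simp only [map_zero]
  | add s t hs ht => simp only [map_add, hs, ht]
  | mk x y n =>
    rw [TensorEnv.mapLeft_mk, TensorA.map_mk, contract_mk, contract_mk, TensorEnv.mapLeft_mk,
      LinearMap.comp_apply]

theorem mapLeft_mapLeft {X₂ : Type*} [AddCommGroup X₂] [Module k X₂] [Module (Env k A) X₂]
    [IsScalarTower k (Env k A) X₂] (f : X →ₗ[Env k A] X₁) (g : X₁ →ₗ[Env k A] X₂)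
    (t : TensorEnv k A X N) :
    TensorEnv.mapLeft N g (TensorEnv.mapLeft N f t) = TensorEnv.mapLeft N (g ∘ₗ f) t := by
  induction t using TensorEnv.induction_on with
  | zero => simp only [map_zero]
  | add s t hs ht => simp only [map_add, hs, ht]
  | mk x n => rfl

theorem mapLeft_add (f g : X →ₗ[Env k A] X₁) (t : TensorEnv k A X N) :
    TensorEnv.mapLeft N (f + g) t = TensorEnv.mapLeft N f t + TensorEnv.mapLeft N g t := by
  induction t using TensorEnv.induction_on with
  | zero => simp only [map_zero, add_zero]
  | add s t hs ht => rw [map_add, hs, ht, map_add, map_add]; abel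
  | mk x n => exact TensorEnv.mk_add_left _ _ _

/-- `mapLeft` as an additive map in the morphism. -/
def mapLeftHom (X X₁ N : Type*) [AddCommGroup X] [Module k X] [Module (Env k A) X]
    [IsScalarTower k (Env k A) X] [AddCommGroup X₁] [Module k X₁] [Module (Env k A) X₁]
    [IsScalarTower k (Env k A) X₁] [AddCommGroup N] [Module k N] [Module (Env k A) N]
    [IsScalarTower k (Env k A) N] :
    (X →ₗ[Env k A] X₁) →+ (TensorEnv k A X N →ₗ[k] TensorEnv k A X₁ N) where
  toFun f := TensorEnv.mapLeft N f
  map_zero' := by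
    refine TensorEnv.hom_ext fun x n => ?_
    rw [TensorEnv.mapLeft_mk, LinearMap.zero_apply, LinearMap.zero_apply, TensorEnv.mk,
      TensorProduct.zero_tmul, map_zero]
  map_add' f g := LinearMap.ext fun t => mapLeft_add f g t

theorem mapLeft_zsmul (c : ℤ) (f : X →ₗ[Env k A] X₁) (t : TensorEnv k A X N) :
    TensorEnv.mapLeft N (c • f) t = c • TensorEnv.mapLeft N f t := by
  have h := map_zsmul (mapLeftHom X X₁ N) c f
  exact congrArg (fun F : TensorEnv k A X N →ₗ[k] TensorEnv k A X₁ N => F t) h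

theorem mapLeft_zero (t : TensorEnv k A X N) :
    TensorEnv.mapLeft N (0 : X →ₗ[Env k A] X₁) t = 0 := by
  have h := map_zero (mapLeftHom (k := k) (A := A) X X₁ N)
  exact congrArg (fun F : TensorEnv k A X N →ₗ[k] TensorEnv k A X₁ N => F t) h

end Linear

/-! ### Subquotients -/

section Subquotient

variable {V V' V'' : Type*} [AddCommGroup V] [Module k V] [AddCommGroup V'] [Module k V']
  [AddCommGroup V''] [Module k V'']

/-- The quotient of a subspace `Z` (cycles) by the subspace `B` (boundaries); all uses have
`B ≤ Z`. -/
abbrev Subquotient (Z B : Submodule k V) := Z ⧸ B.submoduleOf Z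

namespace Subquotient

variable {Z B : Submodule k V} {Z' B' : Submodule k V'} {Z'' B'' : Submodule k V''}

/-- The map of subquotients induced by a linear map preserving cycles and boundaries. -/
def map (f : V →ₗ[k] V') (hZ : ∀ z ∈ Z, f z ∈ Z') (hB : ∀ b ∈ B, f b ∈ B') :
    Subquotient Z B →ₗ[k] Subquotient Z' B' :=
  (B.submoduleOf Z).mapQ (B'.submoduleOf Z') (f.restrict hZ) fun b hb => hB b.1 hb

/-- The bilinear map of subquotients induced by a bilinear map. -/
def map₂ (f : V →ₗ[k] V' →ₗ[k] V'') (hZ : ∀ z ∈ Z, ∀ z' ∈ Z', f z z' ∈ Z'')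
    (hl : ∀ b ∈ B, ∀ z' ∈ Z', f b z' ∈ B'') (hr : ∀ z ∈ Z, ∀ b' ∈ B', f z b' ∈ B'') :
    Subquotient Z B →ₗ[k] Subquotient Z' B' →ₗ[k] Subquotient Z'' B'' :=
  (B.submoduleOf Z).liftQ
    { toFun := fun z => map (f z.1) (hZ z.1 z.2) (hr z.1 z.2)
      map_add' := fun z w => by
        refine Submodule.linearMap_qext _ (LinearMap.ext fun z' => ?_)
        refine congrArg (Submodule.Quotient.mk (p := B''.submoduleOf Z'')) (Subtype.ext ?_)
        exact LinearMap.congr_fun (map_add f z.1 w.1) z'.1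
      map_smul' := fun c z => by
        refine Submodule.linearMap_qext _ (LinearMap.ext fun z' => ?_)
        refine congrArg (Submodule.Quotient.mk (p := B''.submoduleOf Z'')) (Subtype.ext ?_)
        exact LinearMap.congr_fun (map_smul f c z.1) z'.1 }
    (by
      intro b hb
      refine LinearMap.mem_ker.2 (Submodule.linearMap_qext _ (LinearMap.ext fun z' => ?_))
      exact (Submodule.Quotient.mk_eq_zero _).2 (hl b.1 hb z'.1 z'.2))

theorem map_mk (f : V →ₗ[k] V') (hZ : ∀ z ∈ Z, f z ∈ Z') (hB : ∀ b ∈ B, f b ∈ B') (z : Z) :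
    map f hZ hB (Submodule.Quotient.mk z) = Submodule.Quotient.mk ⟨f z.1, hZ z.1 z.2⟩ := rfl

theorem map₂_mk (f : V →ₗ[k] V' →ₗ[k] V'') (hZ : ∀ z ∈ Z, ∀ z' ∈ Z', f z z' ∈ Z'')
    (hl : ∀ b ∈ B, ∀ z' ∈ Z', f b z' ∈ B'') (hr : ∀ z ∈ Z, ∀ b' ∈ B', f z b' ∈ B'')
    (z : Z) (z' : Z') :
    map₂ f hZ hl hr (Submodule.Quotient.mk z) (Submodule.Quotient.mk z')
      = Submodule.Quotient.mk ⟨f z.1 z'.1, hZ z.1 z.2 z'.1 z'.2⟩ := rfl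

end Subquotient

end Subquotient

/-! ### Complexes of bimodules and their (co)homology with coefficients -/

/-- Chain complexes of `A`-bimodules, indexed by `ℤ`. -/
abbrev BimodComplex (k : Type u) (A : Type u') [Field k] [Ring A] [Algebra k A] :=
  ChainComplex (ModuleCat.{v} (Env k A)) ℤ

namespace BimodComplex

/-- The differential `C_i → C_j` as a bimodule map; it vanishes unless `i = j + 1`. -/
abbrev diff (C : BimodComplex.{u, u', v} k A) (i j : ℤ) : C.X i →ₗ[Env k A] C.X j := (C.d i j).hom

theorem diff_comp (C : BimodComplex.{u, u', v} k A) (i j l : ℤ) :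
    C.diff j l ∘ₗ C.diff i j = 0 := by
  rw [← ModuleCat.hom_comp, C.d_comp_d]; rfl

theorem diff_diff (C : BimodComplex.{u, u', v} k A) (i j l : ℤ) (x : C.X i) :
    C.diff j l (C.diff i j x) = 0 := LinearMap.congr_fun (C.diff_comp i j l) x

theorem diff_zero (C : BimodComplex.{u, u', v} k A) (i j : ℤ) (h : j + 1 ≠ i) : C.diff i j = 0 := by
  rw [diff, C.shape i j (by simpa using h)]; rfl

variable (C : BimodComplex.{u, u', v} k A)
variable (M : Type w) [AddCommGroup M] [Module k M] [Module (Env k A) M]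
  [IsScalarTower k (Env k A) M]

/-- The differential of the cochain complex `Hom(C, M)`, whose term in degree `n` is
`Hom(C_n, M)`: a cochain `f` of degree `n` is sent to `-(-1)^n f ∘ d`. -/
def homDiff (n m : ℤ) : (C.X n →ₗ[Env k A] M) →ₗ[k] (C.X m →ₗ[Env k A] M) where
  toFun f := -((n.negOnePow : ℤ) • (f ∘ₗ C.diff m n))
  map_add' f g := by rw [LinearMap.add_comp, smul_add, neg_add]
  map_smul' c f := by
    rw [LinearMap.smul_comp, smul_comm, RingHom.id_apply, smul_neg]

/-- The `n`-cocycles of `Hom(C, M)`. -/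
abbrev cocycles (n : ℤ) : Submodule k (C.X n →ₗ[Env k A] M) :=
  LinearMap.ker (C.homDiff M n (n + 1))

/-- The `n`-coboundaries of `Hom(C, M)`. -/
abbrev coboundaries (n : ℤ) : Submodule k (C.X n →ₗ[Env k A] M) :=
  LinearMap.range (C.homDiff M (n - 1) n)

/-- The cohomology `H^n(Hom(C, M))`. -/
abbrev Cohomology (n : ℤ) := Subquotient (C.cocycles M n) (C.coboundaries M n)

/-- The differential `d ⊗ id` of the complex `C ⊗_{A ⊗ Aᵒᵖ} M`. -/
def tensorDiff (n m : ℤ) : TensorEnv k A (C.X n) M →ₗ[k] TensorEnv k A (C.X m) M :=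
  TensorEnv.mapLeft M (C.diff n m)

/-- The `n`-cycles of `C ⊗_{A ⊗ Aᵒᵖ} M`. -/
abbrev cycles (n : ℤ) : Submodule k (TensorEnv k A (C.X n) M) :=
  LinearMap.ker (C.tensorDiff M n (n - 1))

/-- The `n`-boundaries of `C ⊗_{A ⊗ Aᵒᵖ} M`. -/
abbrev boundaries (n : ℤ) : Submodule k (TensorEnv k A (C.X n) M) :=
  LinearMap.range (C.tensorDiff M (n + 1) n)

/-- The homology `H_n(C ⊗_{A ⊗ Aᵒᵖ} M)`. -/
abbrev Homology (n : ℤ) := Subquotient (C.cycles M n) (C.boundaries M n)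

variable {C M}

theorem mem_cocycles {n : ℤ} {f : C.X n →ₗ[Env k A] M} :
    f ∈ C.cocycles M n ↔ f ∘ₗ C.diff (n + 1) n = 0 := by
  rw [LinearMap.mem_ker]
  change -((n.negOnePow : ℤ) • (f ∘ₗ C.diff (n + 1) n)) = 0 ↔ _
  rcases Int.even_or_odd n with h | h
  · simp [Int.negOnePow_even n h]
  · simp [Int.negOnePow_odd n h]

theorem mem_coboundaries {n : ℤ} {f : C.X n →ₗ[Env k A] M} :
    f ∈ C.coboundaries M n ↔ ∃ g : C.X (n - 1) →ₗ[Env k A] M, g ∘ₗ C.diff n (n - 1) = f := by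
  constructor
  · rintro ⟨g, rfl⟩
    refine ⟨-(((n - 1).negOnePow : ℤ) • g), ?_⟩
    ext x; rfl
  · rintro ⟨g, rfl⟩
    refine ⟨-(((n - 1).negOnePow : ℤ) • g), ?_⟩
    change -(((n - 1).negOnePow : ℤ) • ((-(((n - 1).negOnePow : ℤ) • g)) ∘ₗ _)) = _
    rw [LinearMap.neg_comp, LinearMap.smul_comp, smul_neg, neg_neg, smul_smul]
    norm_cast
    rw [Int.units_mul_self, Units.val_one, one_smul]

theorem mem_cycles {n : ℤ} {t : TensorEnv k A (C.X n) M} :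
    t ∈ C.cycles M n ↔ TensorEnv.mapLeft M (C.diff n (n - 1)) t = 0 := Iff.rfl

variable {C' : BimodComplex.{u, u', v} k A}

theorem hom_comm (φ : C ⟶ C') (i j : ℤ) :
    (φ.f j).hom ∘ₗ C.diff i j = C'.diff i j ∘ₗ (φ.f i).hom := by
  have h := congrArg ModuleCat.Hom.hom (φ.comm i j)
  exact h.symm

variable (M) in
/-- The map `H^n(Hom(C', M)) → H^n(Hom(C, M))`, `[f] ↦ [f ∘ φ]`, induced by a chain map
`φ : C → C'`. -/
def cohomologyMap (φ : C ⟶ C') (n : ℤ) : C'.Cohomology M n →ₗ[k] C.Cohomology M n :=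
  Subquotient.map
    ({ toFun := fun f => f ∘ₗ (φ.f n).hom
       map_add' := fun f g => LinearMap.add_comp _ _ _
       map_smul' := fun c f => LinearMap.smul_comp _ _ _ } :
      (C'.X n →ₗ[Env k A] M) →ₗ[k] (C.X n →ₗ[Env k A] M))
    (fun f hf => by
      rw [mem_cocycles] at hf ⊢
      change (f ∘ₗ (φ.f n).hom) ∘ₗ _ = 0
      rw [LinearMap.comp_assoc, hom_comm, ← LinearMap.comp_assoc, hf, LinearMap.zero_comp])
    (fun f hf => by
      rw [mem_coboundaries] at hf ⊢
      obtain ⟨g, rfl⟩ := hf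
      refine ⟨g ∘ₗ (φ.f (n - 1)).hom, ?_⟩
      change _ = (g ∘ₗ _) ∘ₗ _
      rw [LinearMap.comp_assoc, hom_comm, ← LinearMap.comp_assoc])

variable (M) in
/-- The map `H_n(C ⊗ M) → H_n(C' ⊗ M)` induced by a chain map `φ : C → C'`. -/
def homologyMap (φ : C ⟶ C') (n : ℤ) : C.Homology M n →ₗ[k] C'.Homology M n :=
  Subquotient.map (TensorEnv.mapLeft M (φ.f n).hom)
    (fun t ht => by
      rw [mem_cycles] at ht ⊢
      rw [mapLeft_mapLeft, ← hom_comm, ← mapLeft_mapLeft, ht, map_zero])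
    (fun t ht => by
      obtain ⟨s, rfl⟩ := ht
      refine ⟨TensorEnv.mapLeft M (φ.f (n + 1)).hom s, ?_⟩
      rw [tensorDiff, tensorDiff, mapLeft_mapLeft, mapLeft_mapLeft, hom_comm])

end BimodComplex

/-! ### Complete and ordinary tensor products of complexes over `A` -/

/-- The bidegrees `(p, q)` with `p + q = n`. -/
abbrev Bidegree (n : ℤ) := {pq : ℤ × ℤ // pq.1 + pq.2 = n}

section TensorComplex

variable (C C' : BimodComplex.{u, u', v} k A)

/-- The degree `n` part `∏_{p + q = n} C_p ⊗_A C'_q` of the complete tensor product. -/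
abbrev CompleteTensorObj (n : ℤ) : Type v :=
  ∀ pq : Bidegree n, TensorA k A (C.X pq.1.1) (C'.X pq.1.2)

/-- The differential of the complete tensor product: the component in bidegree `(p, q)` of `d x` is
`(d ⊗ id) x_{p+1,q} + (-1)^p (id ⊗ d) x_{p,q+1}`. It is written for arbitrary degrees `n`, `m`,
where `p + 1` becomes `n - q` and `q + 1` becomes `n - p`, and vanishes unless `n = m + 1`. -/
def completeTensorDiff (n m : ℤ) :
    CompleteTensorObj C C' n →ₗ[Env k A] CompleteTensorObj C C' m :=
  LinearMap.pi fun pq =>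
    TensorA.map (C.diff (n - pq.1.2) pq.1.1) LinearMap.id ∘ₗ
        LinearMap.proj (⟨(n - pq.1.2, pq.1.2), by simp⟩ : Bidegree n)
      + (pq.1.1.negOnePow : ℤ) • (TensorA.map LinearMap.id (C'.diff (n - pq.1.1) pq.1.2) ∘ₗ
        LinearMap.proj (⟨(pq.1.1, n - pq.1.1), by simp⟩ : Bidegree n))

theorem completeTensorDiff_apply (n m : ℤ) (x : CompleteTensorObj C C' n) (pq : Bidegree m) :
    completeTensorDiff C C' n m x pq
      = TensorA.map (C.diff (n - pq.1.2) pq.1.1) LinearMap.id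
          (x ⟨(n - pq.1.2, pq.1.2), by simp⟩)
        + (pq.1.1.negOnePow : ℤ) • TensorA.map LinearMap.id (C'.diff (n - pq.1.1) pq.1.2)
          (x ⟨(pq.1.1, n - pq.1.1), by simp⟩) := rfl

theorem completeTensorDiff_succ (m p q : ℤ) (h : p + q = m) (x : CompleteTensorObj C C' (m + 1)) :
    completeTensorDiff C C' (m + 1) m x ⟨(p, q), h⟩
      = TensorA.map (C.diff (p + 1) p) LinearMap.id (x ⟨(p + 1, q), by simp only; omega⟩)
        + (p.negOnePow : ℤ) • TensorA.map LinearMap.id (C'.diff (q + 1) q)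
          (x ⟨(p, q + 1), by simp only; omega⟩) := by
  have h₁ : ∀ p' (hp : p' = p + 1) (hp' : p' + q = m + 1),
      TensorA.map (C.diff p' p) LinearMap.id (x ⟨(p', q), hp'⟩)
        = TensorA.map (C.diff (p + 1) p) LinearMap.id
          (x ⟨(p + 1, q), by simp only; omega⟩) := by
    rintro _ rfl _; rfl
  have h₂ : ∀ q' (hq : q' = q + 1) (hq' : p + q' = m + 1),
      TensorA.map LinearMap.id (C'.diff q' q) (x ⟨(p, q'), hq'⟩)
        = TensorA.map LinearMap.id (C'.diff (q + 1) q)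
          (x ⟨(p, q + 1), by simp only; omega⟩) := by
    rintro _ rfl _; rfl
  rw [completeTensorDiff_apply]
  exact congrArg₂ (· + ·) (h₁ _ (by simp only; omega) _)
    (congrArg _ (h₂ _ (by simp only; omega) _))

theorem completeTensorDiff_shape (n m : ℤ) (h : m + 1 ≠ n) : completeTensorDiff C C' n m = 0 := by
  refine LinearMap.ext fun x => funext fun pq => ?_
  obtain ⟨⟨p, q⟩, hpq⟩ := pq
  rw [completeTensorDiff_apply, C.diff_zero _ _ (by simp only at hpq ⊢; omega),
    C'.diff_zero _ _ (by simp only at hpq ⊢; omega), TensorA.map_zero_left, TensorA.map_zero_right,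
    smul_zero, add_zero]
  rfl

theorem completeTensorDiff_sq (m : ℤ) (x : CompleteTensorObj C C' (m + 1 + 1)) :
    completeTensorDiff C C' (m + 1) m (completeTensorDiff C C' (m + 1 + 1) (m + 1) x) = 0 := by
  funext pq
  obtain ⟨⟨p, q⟩, h⟩ := pq
  rw [completeTensorDiff_succ, completeTensorDiff_succ, completeTensorDiff_succ, map_add, map_add,
    map_zsmul, map_zsmul, TensorA.map_map, TensorA.map_map, TensorA.map_map, TensorA.map_map,
    C.diff_comp, C'.diff_comp, LinearMap.id_comp, LinearMap.id_comp, LinearMap.comp_id,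
    LinearMap.comp_id, LinearMap.id_comp, TensorA.map_zero_left, TensorA.map_zero_right,
    Int.negOnePow_succ, smul_zero, add_zero, zero_add, Units.val_neg, neg_smul, neg_add_cancel]
  rfl

/-- The complete tensor product `C ⊗̂_A C'`. -/
def completeTensor : BimodComplex.{u, u', v} k A where
  X n := ModuleCat.of (Env k A) (CompleteTensorObj C C' n)
  d n m := ModuleCat.ofHom (completeTensorDiff C C' n m)
  shape n m h := by
    rw [completeTensorDiff_shape C C' n m (by simpa using h)]; rfl
  d_comp_d' i j l hij hjl := by
    obtain rfl : j + 1 = i := by simpa using hij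
    obtain rfl : l + 1 = j := by simpa using hjl
    exact ModuleCat.hom_ext (LinearMap.ext fun x => completeTensorDiff_sq C C' l x)

/-- The degree `n` part `⨁_{p + q = n} C_p ⊗_A C'_q` of the tensor product: the families in the
product with only finitely many nonzero components. -/
def tensorObj (n : ℤ) : Submodule (Env k A) (CompleteTensorObj C C' n) where
  carrier := {x | {pq | x pq ≠ 0}.Finite}
  zero_mem' := by simp
  add_mem' {x y} hx hy := (hx.union hy).subset fun pq h => by
    by_contra hc
    simp only [Set.mem_union, Set.mem_ofPred_eq, not_or, not_not] at hc
    exact h (by rw [Pi.add_apply, hc.1, hc.2, add_zero])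
  smul_mem' e x hx := hx.subset fun pq h hc => h (by rw [Pi.smul_apply, hc, smul_zero])

theorem mem_tensorObj {n : ℤ} {x : CompleteTensorObj C C' n} :
    x ∈ tensorObj C C' n ↔ {pq | x pq ≠ 0}.Finite := Iff.rfl

theorem tensorObj_diff (n m : ℤ) (x : CompleteTensorObj C C' n) (hx : x ∈ tensorObj C C' n) :
    completeTensorDiff C C' n m x ∈ tensorObj C C' m := by
  rw [mem_tensorObj] at hx ⊢
  let a : Bidegree m → Bidegree n := fun pq => ⟨(n - pq.1.2, pq.1.2), by simp⟩
  let b : Bidegree m → Bidegree n := fun pq => ⟨(pq.1.1, n - pq.1.1), by simp⟩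
  have ha : Function.Injective a := by
    rintro ⟨⟨p, q⟩, h⟩ ⟨⟨p', q'⟩, h'⟩ e
    simp only [a, Subtype.mk.injEq, Prod.mk.injEq] at e h h' ⊢
    omega
  have hb : Function.Injective b := by
    rintro ⟨⟨p, q⟩, h⟩ ⟨⟨p', q'⟩, h'⟩ e
    simp only [b, Subtype.mk.injEq, Prod.mk.injEq] at e h h' ⊢
    omega
  refine ((hx.preimage ha.injOn).union (hx.preimage hb.injOn)).subset fun pq h => ?_
  by_contra hc
  simp only [Set.mem_union, Set.mem_preimage, Set.mem_ofPred_eq, not_or, not_not] at hc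
  refine h ?_
  rw [completeTensorDiff_apply]
  have h₁ : x ⟨(n - pq.1.2, pq.1.2), by simp⟩ = 0 := hc.1
  have h₂ : x ⟨(pq.1.1, n - pq.1.1), by simp⟩ = 0 := hc.2
  rw [h₁, h₂, map_zero, map_zero, smul_zero, add_zero]

/-- The tensor product `C ⊗_A C'`, with the differential `d ⊗ id + (-1)^p id ⊗ d`. -/
def tensorComplex : BimodComplex.{u, u', v} k A where
  X n := ModuleCat.of (Env k A) (tensorObj C C' n)
  d n m := ModuleCat.ofHom
    ((completeTensorDiff C C' n m).restrict fun x hx => tensorObj_diff C C' n m x hx)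
  shape n m h := by
    refine ModuleCat.hom_ext (LinearMap.ext fun x => Subtype.ext ?_)
    change completeTensorDiff C C' n m x.1 = 0
    rw [completeTensorDiff_shape C C' n m (by simpa using h)]; rfl
  d_comp_d' i j l hij hjl := by
    obtain rfl : j + 1 = i := by simpa using hij
    obtain rfl : l + 1 = j := by simpa using hjl
    exact ModuleCat.hom_ext (LinearMap.ext fun x =>
      Subtype.ext (completeTensorDiff_sq C C' l x.1))

/-- The component in bidegree `(p, q)`, `p + q = n`, of the complete tensor product. -/
def completeTensorProj (p q n : ℤ) (h : p + q = n) :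
    (completeTensor C C').X n →ₗ[Env k A] TensorA k A (C.X p) (C'.X q) :=
  LinearMap.proj (R := Env k A) (φ := fun pq : Bidegree n => TensorA k A (C.X pq.1.1) (C'.X pq.1.2))
    ⟨(p, q), h⟩

/-- The component in bidegree `(p, q)`, `p + q = n`, of the tensor product. -/
def tensorProj (p q n : ℤ) (h : p + q = n) :
    (tensorComplex C C').X n →ₗ[Env k A] TensorA k A (C.X p) (C'.X q) :=
  (LinearMap.proj (R := Env k A)
    (φ := fun pq : Bidegree n => TensorA k A (C.X pq.1.1) (C'.X pq.1.2)) ⟨(p, q), h⟩) ∘ₗ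
    (tensorObj C C' n).subtype

theorem completeTensorProj_diff (p q m : ℤ) (h : p + q = m)
    (x : (completeTensor C C').X (m + 1)) :
    completeTensorProj C C' p q m h ((completeTensor C C').diff (m + 1) m x)
      = TensorA.map (C.diff (p + 1) p) LinearMap.id
          (completeTensorProj C C' (p + 1) q (m + 1) (by omega) x)
        + (p.negOnePow : ℤ) • TensorA.map LinearMap.id (C'.diff (q + 1) q)
          (completeTensorProj C C' p (q + 1) (m + 1) (by omega) x) :=
  completeTensorDiff_succ C C' m p q h x

theorem tensorProj_diff (p q m : ℤ) (h : p + q = m) (x : (tensorComplex C C').X (m + 1)) :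
    tensorProj C C' p q m h ((tensorComplex C C').diff (m + 1) m x)
      = TensorA.map (C.diff (p + 1) p) LinearMap.id
          (tensorProj C C' (p + 1) q (m + 1) (by omega) x)
        + (p.negOnePow : ℤ) • TensorA.map LinearMap.id (C'.diff (q + 1) q)
          (tensorProj C C' p (q + 1) (m + 1) (by omega) x) :=
  completeTensorDiff_succ C C' m p q h x.1

end TensorComplex

/-! ### Products induced by a diagonal map -/

/-- The components `C_n → C_p ⊗_A C_q`, `p + q = n`, of a chain map from `C` to its (ordinary or
complete) tensor square. -/
structure DiagonalComponents (C : BimodComplex.{u, u', v} k A) where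
  /-- The components. -/
  comp : ∀ p q n : ℤ, p + q = n → (C.X n →ₗ[Env k A] TensorA k A (C.X p) (C.X q))
  /-- Compatibility with the differentials. -/
  comp_diff : ∀ (p q n : ℤ) (h : p + q = n) (x : C.X (n + 1)),
    comp p q n h (C.diff (n + 1) n x)
      = TensorA.map (C.diff (p + 1) p) LinearMap.id (comp (p + 1) q (n + 1) (by omega) x)
        + (p.negOnePow : ℤ) • TensorA.map LinearMap.id (C.diff (q + 1) q)
          (comp p (q + 1) (n + 1) (by omega) x)

/-- The components of a chain map `C → C ⊗̂_A C`. -/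
def DiagonalComponents.ofComplete {C : BimodComplex.{u, u', v} k A} (Δ : C ⟶ completeTensor C C) :
    DiagonalComponents C where
  comp p q n h := completeTensorProj C C p q n h ∘ₗ (Δ.f n).hom
  comp_diff p q n h x := by
    have hc : (Δ.f n).hom (C.diff (n + 1) n x)
        = (completeTensor C C).diff (n + 1) n ((Δ.f (n + 1)).hom x) :=
      LinearMap.congr_fun (BimodComplex.hom_comm Δ (n + 1) n) x
    rw [LinearMap.comp_apply, hc, completeTensorProj_diff]
    rfl

/-- The components of a chain map `C → C ⊗_A C`. -/
def DiagonalComponents.ofOrdinary {C : BimodComplex.{u, u', v} k A} (Δ : C ⟶ tensorComplex C C) :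
    DiagonalComponents C where
  comp p q n h := tensorProj C C p q n h ∘ₗ (Δ.f n).hom
  comp_diff p q n h x := by
    have hc : (Δ.f n).hom (C.diff (n + 1) n x)
        = (tensorComplex C C).diff (n + 1) n ((Δ.f (n + 1)).hom x) :=
      LinearMap.congr_fun (BimodComplex.hom_comm Δ (n + 1) n) x
    rw [LinearMap.comp_apply, hc, tensorProj_diff]
    rfl

namespace DiagonalComponents

variable {C : BimodComplex.{u, u', v} k A} (D : DiagonalComponents C)
variable {M : Type w} [AddCommGroup M] [Module k M] [Module (Env k A) M]
  [IsScalarTower k (Env k A) M]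
variable {N : Type w'} [AddCommGroup N] [Module k N] [Module (Env k A) N]
  [IsScalarTower k (Env k A) N]

theorem comp_diff_eq {p q n p' q' n' : ℤ} (h : p + q = n) (hp : p + 1 = p') (hq : q + 1 = q')
    (hn : n + 1 = n') :
    D.comp p q n h ∘ₗ C.diff n' n
      = TensorA.map (C.diff p' p) LinearMap.id ∘ₗ D.comp p' q n' (by omega)
        + (p.negOnePow : ℤ) • (TensorA.map LinearMap.id (C.diff q' q) ∘ₗ
          D.comp p q' n' (by omega)) := by
  subst hp hq hn
  exact LinearMap.ext fun x => D.comp_diff p q n h x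

/-- `(u ⊗_A v) Δ` without its sign. -/
def cupAux {r s n : ℤ} (h : r + s = n) (u : C.X r →ₗ[Env k A] M) (v : C.X s →ₗ[Env k A] N) :
    C.X n →ₗ[Env k A] TensorA k A M N :=
  TensorA.map u v ∘ₗ D.comp r s n h

theorem cupAux_diff {p q n p' q' n' : ℤ} (h : p + q = n) (hp : p + 1 = p') (hq : q + 1 = q')
    (hn : n + 1 = n') (u : C.X p →ₗ[Env k A] M) (v : C.X q →ₗ[Env k A] N) :
    D.cupAux h u v ∘ₗ C.diff n' n
      = D.cupAux (by omega : p' + q = n') (u ∘ₗ C.diff p' p) v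
        + (p.negOnePow : ℤ) • D.cupAux (by omega : p + q' = n') u (v ∘ₗ C.diff q' q) := by
  refine LinearMap.ext fun x => ?_
  have h₁ := LinearMap.congr_fun (D.comp_diff_eq h hp hq hn) x
  simp only [LinearMap.comp_apply, LinearMap.add_apply, LinearMap.smul_apply] at h₁
  simp only [cupAux, LinearMap.comp_apply, LinearMap.add_apply, LinearMap.smul_apply, h₁, map_add,
    map_zsmul, TensorA.map_map, LinearMap.comp_id]

/-- The cup product of cochains: `u ⌣ v = (u ⊗_A v) Δ`. As `M` and `N` sit in degree `0`, only the
component `C_n → C_r ⊗_A C_s` of `Δ` contributes, and `(u ⊗ v)(x ⊗ y) = (-1)^{|v| |x|} u x ⊗ v y`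
gives the sign `(-1)^{rs}`. -/
def cochainCup {r s n : ℤ} (h : r + s = n) :
    (C.X r →ₗ[Env k A] M) →ₗ[k] (C.X s →ₗ[Env k A] N) →ₗ[k]
      (C.X n →ₗ[Env k A] TensorA k A M N) :=
  LinearMap.mk₂ k (fun u v => ((r * s).negOnePow : ℤ) • D.cupAux h u v)
    (fun u u' v => by
      rw [← smul_add]
      exact congrArg _ (LinearMap.ext fun x => TensorA.map_add_left _ _ _ _))
    (fun c u v => by
      rw [smul_comm]
      exact congrArg _ (LinearMap.ext fun x => TensorA.map_smul_left _ _ _ _))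
    (fun u v v' => by
      rw [← smul_add]
      exact congrArg _ (LinearMap.ext fun x => TensorA.map_add_right _ _ _ _))
    (fun c u v => by
      rw [smul_comm]
      exact congrArg _ (LinearMap.ext fun x => TensorA.map_smul_right _ _ _ _))

theorem cochainCup_apply {r s n : ℤ} (h : r + s = n) (u : C.X r →ₗ[Env k A] M)
    (v : C.X s →ₗ[Env k A] N) :
    D.cochainCup h u v = ((r * s).negOnePow : ℤ) • D.cupAux h u v := rfl

theorem cupAux_zero_left {r s n : ℤ} (h : r + s = n) (v : C.X s →ₗ[Env k A] N) :
    D.cupAux h (0 : C.X r →ₗ[Env k A] M) v = 0 :=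
  LinearMap.ext fun _ => TensorA.map_zero_left _ _

theorem cupAux_zero_right {r s n : ℤ} (h : r + s = n) (u : C.X r →ₗ[Env k A] M) :
    D.cupAux h u (0 : C.X s →ₗ[Env k A] N) = 0 :=
  LinearMap.ext fun _ => TensorA.map_zero_right _ _

/-- The cup product `H^r(Hom(C, M)) × H^s(Hom(C, N)) → H^n(Hom(C, M ⊗_A N))`, `n = r + s`. -/
def cup {r s n : ℤ} (h : r + s = n) :
    C.Cohomology M r →ₗ[k] C.Cohomology N s →ₗ[k] C.Cohomology (TensorA k A M N) n :=
  Subquotient.map₂ (D.cochainCup h)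
    (fun u hu v hv => by
      rw [BimodComplex.mem_cocycles] at hu hv
      rw [cochainCup_apply, BimodComplex.mem_cocycles, LinearMap.smul_comp,
        D.cupAux_diff h rfl rfl rfl, hu, hv, cupAux_zero_left, cupAux_zero_right, smul_zero,
        add_zero, smul_zero])
    (fun u hu v hv => by
      rw [BimodComplex.mem_cocycles] at hv
      obtain ⟨g, rfl⟩ := BimodComplex.mem_coboundaries.1 hu
      rw [cochainCup_apply]
      refine zsmul_mem (BimodComplex.mem_coboundaries.2
        ⟨D.cupAux (by omega : (r - 1) + s = n - 1) g v, ?_⟩) _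
      rw [D.cupAux_diff _ (sub_add_cancel r 1) rfl (sub_add_cancel n 1), hv, cupAux_zero_right,
        smul_zero, add_zero])
    (fun u hu v hv => by
      rw [BimodComplex.mem_cocycles] at hu
      obtain ⟨g, rfl⟩ := BimodComplex.mem_coboundaries.1 hv
      rw [cochainCup_apply]
      refine zsmul_mem (BimodComplex.mem_coboundaries.2
        ⟨(r.negOnePow : ℤ) • D.cupAux (by omega : r + (s - 1) = n - 1) u g, ?_⟩) _
      rw [LinearMap.smul_comp, D.cupAux_diff _ rfl (sub_add_cancel s 1) (sub_add_cancel n 1), hu,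
        cupAux_zero_left, zero_add, smul_smul]
      norm_cast
      rw [Int.units_mul_self, Units.val_one, one_smul])

/-- `γ (u ⊗ (Δ ⊗ id) z)` without its sign. -/
def capAux (N : Type w') [AddCommGroup N] [Module k N] [Module (Env k A) N]
    [IsScalarTower k (Env k A) N] {t r s : ℤ} (h : t + r = s) (u : C.X r →ₗ[Env k A] M) :
    TensorEnv k A (C.X s) N →ₗ[k] TensorEnv k A (C.X t) (TensorA k A M N) :=
  contract (C.X t) N u ∘ₗ TensorEnv.mapLeft N (D.comp t r s h)

theorem capAux_diff {t r s t' r' s' : ℤ} (h : t + r = s) (ht : t + 1 = t') (hr : r + 1 = r')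
    (hs : s + 1 = s') (u : C.X r →ₗ[Env k A] M) (z : TensorEnv k A (C.X s') N) :
    D.capAux N h u (TensorEnv.mapLeft N (C.diff s' s) z)
      = TensorEnv.mapLeft (TensorA k A M N) (C.diff t' t)
          (D.capAux N (by omega : t' + r = s') u z)
        + (t.negOnePow : ℤ) • D.capAux N (by omega : t + r' = s') (u ∘ₗ C.diff r' r) z := by
  simp only [capAux, LinearMap.comp_apply]
  rw [mapLeft_mapLeft, D.comp_diff_eq h ht hr hs, mapLeft_add, mapLeft_zsmul, map_add, map_zsmul,
    ← mapLeft_mapLeft, ← mapLeft_mapLeft, contract_mapLeft, contract_mapLeft, LinearMap.comp_id]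
  congr 2
  generalize contract (C.X t) N (u ∘ₗ C.diff r' r) _ = y
  induction y using TensorEnv.induction_on with
  | zero => rw [map_zero]
  | add a b ha hb => rw [map_add, ha, hb]
  | mk x n => rfl

/-- The cap product of a cochain and a chain: `u ⌢ z = γ (u ⊗ (Δ ⊗ id) z)`, where
`γ (u ⊗ (x ⊗ y) ⊗ n) = (-1)^{|u| |x|} x ⊗ (u y ⊗ n)`; as `M` sits in degree `0`, only the component
`C_s → C_t ⊗_A C_r` of `Δ` contributes. -/
def chainCap (M : Type w) [AddCommGroup M] [Module k M] [Module (Env k A) M]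
    [IsScalarTower k (Env k A) M] (N : Type w') [AddCommGroup N] [Module k N] [Module (Env k A) N]
    [IsScalarTower k (Env k A) N] {t r s : ℤ} (h : t + r = s) :
    (C.X r →ₗ[Env k A] M) →ₗ[k] TensorEnv k A (C.X s) N →ₗ[k]
      TensorEnv k A (C.X t) (TensorA k A M N) where
  toFun u := ((r * t).negOnePow : ℤ) • D.capAux N h u
  map_add' u u' := by
    rw [← smul_add]
    exact congrArg _ (LinearMap.ext fun z => contract_add _ _ _)
  map_smul' c u := by
    rw [RingHom.id_apply, smul_comm]
    exact congrArg _ (LinearMap.ext fun z => contract_smul _ _ _)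

theorem chainCap_apply {t r s : ℤ} (h : t + r = s) (u : C.X r →ₗ[Env k A] M)
    (z : TensorEnv k A (C.X s) N) :
    D.chainCap M N h u z = ((r * t).negOnePow : ℤ) • D.capAux N h u z := rfl

theorem capAux_zero {t r s : ℤ} (h : t + r = s) (z : TensorEnv k A (C.X s) N) :
    D.capAux N h (0 : C.X r →ₗ[Env k A] M) z = 0 := contract_zero _

/-- The cap product `H^r(Hom(C, M)) × H_s(C ⊗ N) → H_t(C ⊗ (M ⊗_A N))`, `t = s - r`. -/
def cap {t r s : ℤ} (h : t + r = s) :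
    C.Cohomology M r →ₗ[k] C.Homology N s →ₗ[k] C.Homology (TensorA k A M N) t :=
  Subquotient.map₂ (D.chainCap M N h)
    (fun u hu z hz => by
      rw [BimodComplex.mem_cocycles] at hu
      rw [BimodComplex.mem_cycles] at hz
      have e := D.capAux_diff (by omega : (t - 1) + r = s - 1) (sub_add_cancel t 1) rfl
        (sub_add_cancel s 1) u z
      rw [hu, hz, map_zero, capAux_zero, smul_zero, add_zero] at e
      rw [chainCap_apply, BimodComplex.mem_cycles, map_zsmul, ← e, smul_zero])
    (fun u hu z hz => by
      rw [BimodComplex.mem_cycles] at hz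
      obtain ⟨g, rfl⟩ := BimodComplex.mem_coboundaries.1 hu
      have e := D.capAux_diff (by omega : t + (r - 1) = s - 1) rfl (sub_add_cancel r 1)
        (sub_add_cancel s 1) g z
      rw [hz, map_zero] at e
      rw [chainCap_apply]
      refine zsmul_mem (LinearMap.mem_range.2
        ⟨-((t.negOnePow : ℤ) • D.capAux N (by omega : (t + 1) + (r - 1) = s) g z), ?_⟩) _
      rw [BimodComplex.tensorDiff, map_neg, map_zsmul, neg_eq_iff_eq_neg, ← sub_eq_zero,
        sub_neg_eq_add]
      have e' := congrArg (fun y => (t.negOnePow : ℤ) • y) e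
      simp only [smul_zero, smul_add, smul_smul] at e'
      norm_cast at e'
      rw [Int.units_mul_self, Units.val_one, one_smul] at e'
      exact_mod_cast e'.symm)
    (fun u hu z hz => by
      rw [BimodComplex.mem_cocycles] at hu
      obtain ⟨y, rfl⟩ := hz
      have e := D.capAux_diff h rfl rfl rfl u y
      rw [hu, capAux_zero, smul_zero, add_zero] at e
      rw [chainCap_apply]
      exact zsmul_mem (LinearMap.mem_range.2
        ⟨D.capAux N (by omega : (t + 1) + r = s + 1) u y, e.symm⟩) _)

end DiagonalComponents

/-! ### Projective resolutions and ordinary Hochschild theory -/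

/-- A projective resolution `ε : P → A` of the bimodule `A` by finitely generated projective
bimodules. -/
structure ProjRes (k : Type u) (A : Type u') [Field k] [Ring A] [Algebra k A] where
  /-- The complex `P`. -/
  cplx : BimodComplex.{u, u', v} k A
  /-- The augmentation. -/
  aug : cplx.X 0 →ₗ[Env k A] Regular k A
  finite : ∀ n, Module.Finite (Env k A) (cplx.X n)
  projective : ∀ n, Module.Projective (Env k A) (cplx.X n)
  zero_of_neg : ∀ n < 0, Subsingleton (cplx.X n)
  exact_pos : ∀ n > 0, Function.Exact (cplx.diff (n + 1) n) (cplx.diff n (n - 1))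
  exact_zero : Function.Exact (cplx.diff 1 0) aug
  aug_surjective : Function.Surjective aug

/-- A complete resolution `T → A`: an exact complex `T` of finitely generated projective bimodules
whose dual `Hom(T, A ⊗ Aᵒᵖ)` is exact, with an augmentation `ε : T_0 → A` that makes the truncation
`T_{≥ 0}` a projective resolution of `A`. -/
structure CompleteRes (k : Type u) (A : Type u') [Field k] [Ring A] [Algebra k A] where
  /-- The complex `T`. -/
  cplx : BimodComplex.{u, u', v} k A
  /-- The augmentation. -/
  aug : cplx.X 0 →ₗ[Env k A] Regular k A
  finite : ∀ n, Module.Finite (Env k A) (cplx.X n)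
  projective : ∀ n, Module.Projective (Env k A) (cplx.X n)
  exact : ∀ n, Function.Exact (cplx.diff (n + 1) n) (cplx.diff n (n - 1))
  dual_exact : ∀ n, Subsingleton (cplx.Cohomology (Env k A) n)
  exact_zero : Function.Exact (cplx.diff 1 0) aug
  aug_surjective : Function.Surjective aug

/-- A diagonal approximation `Δ : P → P ⊗_A P` of a projective resolution: an
augmentation-preserving chain map, `(ε ⊗_A ε) Δ = ε`. -/
structure DiagonalApprox (P : ProjRes.{u, u', v} k A) where
  /-- The chain map. -/
  hom : P.cplx ⟶ tensorComplex P.cplx P.cplx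
  aug_hom : ∀ x : P.cplx.X 0,
    augTensor P.aug P.aug (tensorProj P.cplx P.cplx 0 0 0 (add_zero 0) ((hom.f 0).hom x)) = P.aug x

/-- A diagonal approximation `Δ : T → T ⊗̂_A T` of a complete resolution: a chain map with
`(ε ⊗̂_A ε) Δ = ε`. -/
structure CompleteDiagonalApprox (T : CompleteRes.{u, u', v} k A) where
  /-- The chain map. -/
  hom : T.cplx ⟶ completeTensor T.cplx T.cplx
  aug_hom : ∀ x : T.cplx.X 0,
    augTensor T.aug T.aug (completeTensorProj T.cplx T.cplx 0 0 0 (add_zero 0) ((hom.f 0).hom x))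
      = T.aug x

section Theory

variable (P : ProjRes.{u, u', v} k A) (T : CompleteRes.{u, u', v} k A)
variable (M : Type w) [AddCommGroup M] [Module k M] [Module (Env k A) M]
  [IsScalarTower k (Env k A) M]
variable (N : Type w') [AddCommGroup N] [Module k N] [Module (Env k A) N]
  [IsScalarTower k (Env k A) N]

/-- Hochschild cohomology `H^n(A, M)`, computed by the projective resolution `P`. -/
abbrev HochschildCohomology (n : ℤ) := P.cplx.Cohomology M n

/-- Hochschild homology `H_n(A, M)`, computed by the projective resolution `P`. -/
abbrev HochschildHomology (n : ℤ) := P.cplx.Homology M n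

/-- Tate-Hochschild cohomology `Ĥ^n(A, M)`, computed by the complete resolution `T`. -/
abbrev TateCohomology (n : ℤ) := T.cplx.Cohomology M n

/-- Tate-Hochschild homology `Ĥ_n(A, M)`, computed by the complete resolution `T`. -/
abbrev TateHomology (n : ℤ) := T.cplx.Homology M n

variable {P T M N}

/-- The cup product `H^r(A, M) × H^s(A, N) → H^n(A, M ⊗_A N)`, `n = r + s`. -/
def hochschildCup (Δ : DiagonalApprox P) {r s n : ℤ} (h : r + s = n) :
    HochschildCohomology P M r →ₗ[k] HochschildCohomology P N s →ₗ[k]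
      HochschildCohomology P (TensorA k A M N) n :=
  (DiagonalComponents.ofOrdinary Δ.hom).cup h

/-- The cap product `H^r(A, M) × H_s(A, N) → H_t(A, M ⊗_A N)`, `t = s - r`. -/
def hochschildCap (Δ : DiagonalApprox P) {t r s : ℤ} (h : t + r = s) :
    HochschildCohomology P M r →ₗ[k] HochschildHomology P N s →ₗ[k]
      HochschildHomology P (TensorA k A M N) t :=
  (DiagonalComponents.ofOrdinary Δ.hom).cap h

/-- The cup product `Ĥ^r(A, M) × Ĥ^s(A, N) → Ĥ^n(A, M ⊗_A N)`, `n = r + s`. -/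
def tateCup (Δ : CompleteDiagonalApprox T) {r s n : ℤ} (h : r + s = n) :
    TateCohomology T M r →ₗ[k] TateCohomology T N s →ₗ[k]
      TateCohomology T (TensorA k A M N) n :=
  (DiagonalComponents.ofComplete Δ.hom).cup h

/-- The cap product `Ĥ^r(A, M) × Ĥ_s(A, N) → Ĥ_t(A, M ⊗_A N)`, `t = s - r`. -/
def tateCap (Δ : CompleteDiagonalApprox T) {t r s : ℤ} (h : t + r = s) :
    TateCohomology T M r →ₗ[k] TateHomology T N s →ₗ[k]
      TateHomology T (TensorA k A M N) t :=
  (DiagonalComponents.ofComplete Δ.hom).cap h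

/-- An augmentation-preserving chain map `ϑ : T → P` from a complete resolution to a projective
resolution of `A`, such as the canonical map onto the truncation `T_{≥ 0}`. -/
structure Comparison (T : CompleteRes.{u, u', v} k A) (P : ProjRes.{u, u', v} k A) where
  /-- The chain map. -/
  hom : T.cplx ⟶ P.cplx
  aug_hom : ∀ x : T.cplx.X 0, P.aug ((hom.f 0).hom x) = T.aug x

variable (M) in
/-- The canonical map `H^n(A, M) → Ĥ^n(A, M)`. -/
def Comparison.toTate (ϑ : Comparison T P) (n : ℤ) :
    HochschildCohomology P M n →ₗ[k] TateCohomology T M n :=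
  BimodComplex.cohomologyMap M ϑ.hom n

variable (M) in
/-- The canonical map `Ĥ_n(A, M) → H_n(A, M)`. -/
def Comparison.ofTate (ϑ : Comparison T P) (n : ℤ) :
    TateHomology T M n →ₗ[k] HochschildHomology P M n :=
  BimodComplex.homologyMap M ϑ.hom n

end Theory

end TateHochschild

end

set_option linter.unusedSectionVars false

noncomputable section

namespace TateHochschild

universe u u' v w w'

variable {k : Type u} {A : Type u'} [Field k] [Ring A] [Algebra k A]

/-! In nonnegative degrees `T` and `P` are both resolutions of `A` by projectives, so they agree
there up to homotopy. Lifting the identity of `A` gives maps `ψ : P → T` that commute with the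
differentials between nonnegative degrees, and both composites with `ϑ` have the form `id + d a + b
d` in each degree `n ≥ 0` (`Comparison.exists_inverse`). In general `ψ` is not a chain map at the
edge: `d ψ_0` need not vanish in `T_{-1}`, whereas `P_{-1} = 0`. This is why degree zero gives only
half of the bijection. Surjectivity on cohomology and injectivity on homology use `ψ` between
degrees `n + 1` and `n`; the other halves use it between degrees `n` and `n - 1`, hence need `n >
0`.

For the products, both `Δ ϑ` and `(ϑ ⊗ ϑ) Δ̂` are augmentation-preserving maps from `T` to `P ⊗_A
P`. As `P` vanishes in negative degrees, each degree of `P ⊗_A P` has only finitely many nonzero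
components, so it may be treated as a complete tensor product. The two maps are homotopic because
`T` consists of projectives and `P ⊗_A P` is exact in positive degrees, with the kernel of `ε ⊗ ε`
in degree zero consisting of boundaries; in negative degrees the target is zero. This is
`Comparison.exists_diagonal_homotopy`.

Exactness of `P ⊗_A P` comes from the right module structure. A projective bimodule is projective as
a right `A`-module, so the augmented complex `P → A` has a contraction `s` by right linear maps
(`ProjRes.exists_contraction`). Such maps can be tensored over `A` with the identity of the second
factor, and `s ⊗ id` reduces the homology of `P ⊗_A P` to that of `A ⊗_A P = P`.

Finally the homotopy is inserted into the products. For cocycles `u` and `v`, the map `u ⊗ v`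
annihilates the `d a` part and turns the `b d` part into a coboundary. For caps, a cycle `z`
annihilates the `b d` part, and contraction with the cocycle `u` turns the `d a` part into a
boundary. Hence `Comparison.toTate_cup` and `Comparison.ofTate_cap`; the cases of the second
statement are instances of the latter. -/

/-! ### Lifting and null-homotopies over projectives. -/

/-- Dependent choice along the natural numbers. -/
theorem exists_seq_of_step {α : ℕ → Type*} (p : ∀ n, α n → Prop) (r : ∀ n, α n → α (n + 1) → Prop)
    (x₀ : α 0) (hx₀ : p 0 x₀) (hs : ∀ n x, p n x → ∃ y, p (n + 1) y ∧ r n x y) :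
    ∃ f : ∀ n, α n, f 0 = x₀ ∧ (∀ n, p n (f n)) ∧ ∀ n, r n (f n) (f (n + 1)) := by
  choose g hg hr using hs
  let f : ∀ n, {x : α n // p n x} := fun n =>
    Nat.rec ⟨x₀, hx₀⟩ (fun n x => ⟨g n x.1 x.2, hg n x.1 x.2⟩) n
  exact ⟨fun n => (f n).1, rfl, fun n => (f n).2, fun n => hr n (f n).1 (f n).2⟩

/-- Lifting a map out of a projective module along a map whose range contains its range. -/
theorem exists_lift_of_projective {R : Type*} [Ring R] {X Y Z : Type*} [AddCommGroup X]
    [Module R X] [AddCommGroup Y] [Module R Y] [AddCommGroup Z] [Module R Z]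
    [Module.Projective R X] (g : Y →ₗ[R] Z) (f : X →ₗ[R] Z) (h : ∀ x, ∃ y, g y = f x) :
    ∃ l : X →ₗ[R] Y, g ∘ₗ l = f := by
  obtain ⟨l, hl⟩ := Module.projective_lifting_property g.rangeRestrict
    (f.codRestrict (LinearMap.range g) h) g.surjective_rangeRestrict
  exact ⟨l, LinearMap.ext fun x => congrArg Subtype.val (LinearMap.congr_fun hl x)⟩

/-- A family of maps in nonnegative degrees that commutes with the differentials, out of a complex
of projectives and into a complex that is exact in positive degrees, is null-homotopic in every
nonnegative degree as soon as it takes boundaries as values in degree zero. -/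
theorem exists_nullhomotopy {C Q : BimodComplex.{u, u', v} k A}
    (hC : ∀ n, Module.Projective (Env k A) (C.X n))
    (hQ : ∀ i j l : ℤ, 0 < j → j + 1 = i → l + 1 = j → ∀ x : Q.X j, Q.diff j l x = 0 →
      ∃ y, Q.diff i j y = x)
    (φ : ∀ n, C.X n →ₗ[Env k A] Q.X n)
    (hφ : ∀ i j : ℤ, 0 ≤ j → j + 1 = i → Q.diff i j ∘ₗ φ i = φ j ∘ₗ C.diff i j)
    (h₀ : ∀ x, ∃ y, Q.diff 1 0 y = φ 0 x) (i j l : ℤ) (hj : 0 ≤ j) (hij : j + 1 = i)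
    (hjl : l + 1 = j) :
    ∃ (a : C.X j →ₗ[Env k A] Q.X i) (b : C.X l →ₗ[Env k A] Q.X j),
      φ j = Q.diff i j ∘ₗ a + b ∘ₗ C.diff j l := by
  induction j, hj using Int.leInduction generalizing i l with
  | base =>
    obtain rfl : i = 1 := by omega
    have := hC 0
    obtain ⟨a, ha⟩ := exists_lift_of_projective (Q.diff 1 0) (φ 0) h₀
    -- In degree zero `φ 0` already factors through the boundaries, so nothing has to come from
    -- degree `-1`.
    exact ⟨a, 0, by rw [ha, LinearMap.zero_comp, add_zero]⟩
  | succ j hj ih =>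
    obtain rfl : l = j := by omega
    obtain ⟨a, b, hab⟩ := ih (l + 1) (l - 1) rfl (by omega)
    have := hC (l + 1)
    -- With `φ = d a + b d` one degree below, `d (φ - a d) = φ d - d a d = b d d = 0`, so exactness
    -- allows `φ - a d` to be lifted to `c`. The previous `a` then takes the role of `b`.
    obtain ⟨c, hc⟩ := exists_lift_of_projective (Q.diff i (l + 1))
      (φ (l + 1) - a ∘ₗ C.diff (l + 1) l) (fun x => hQ i (l + 1) l (by omega) hij rfl _ (by
        have h₁ := LinearMap.congr_fun (hφ (l + 1) l hj rfl) x
        have h₂ := LinearMap.congr_fun hab (C.diff (l + 1) l x)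
        simp only [LinearMap.comp_apply, LinearMap.add_apply] at h₁ h₂
        rw [C.diff_diff, map_zero, add_zero] at h₂
        rw [LinearMap.sub_apply, map_sub, h₁, h₂, LinearMap.comp_apply, sub_self]))
    exact ⟨c, a, by rw [hc, sub_add_cancel]⟩

/-! ### Comparison of the two resolutions in nonnegative degrees. -/

/-- Exactness with free indices tied by equations, so that no transport between equal degrees is
needed later. -/
theorem ProjRes.exact (P : ProjRes.{u, u', v} k A) {i j l : ℤ} (hj : 0 < j) (hi : j + 1 = i)
    (hl : l + 1 = j) : Function.Exact (P.cplx.diff i j) (P.cplx.diff j l) := by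
  subst hi
  obtain rfl : l = j - 1 := by omega
  exact P.exact_pos j hj

theorem CompleteRes.exact_of_eq (T : CompleteRes.{u, u', v} k A) {i j l : ℤ} (hi : j + 1 = i)
    (hl : l + 1 = j) : Function.Exact (T.cplx.diff i j) (T.cplx.diff j l) := by
  subst hi
  obtain rfl : l = j - 1 := by omega
  exact T.exact j

/-- An augmentation-preserving chain map in nonnegative degrees from a projective resolution to a
complete resolution. -/
theorem exists_lift_to_complete (P : ProjRes.{u, u', v} k A) (T : CompleteRes.{u, u', v} k A) :
    ∃ ψ : ∀ n, P.cplx.X n →ₗ[Env k A] T.cplx.X n, (∀ x, T.aug (ψ 0 x) = P.aug x) ∧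
      ∀ i j : ℤ, 0 ≤ j → j + 1 = i → T.cplx.diff i j ∘ₗ ψ i = ψ j ∘ₗ P.cplx.diff i j := by
  have hproj := P.projective
  obtain ⟨f₀, hf₀⟩ := exists_lift_of_projective T.aug P.aug fun x => T.aug_surjective _
  obtain ⟨f, rfl, -, hf⟩ := exists_seq_of_step
    (α := fun n : ℕ => P.cplx.X (n : ℤ) →ₗ[Env k A] T.cplx.X (n : ℤ))
    -- The invariant that makes the next lift possible: `f d` lands in cycles of `T`, which are
    -- boundaries. In degree zero the augmentation gives it: `ε f₀ d = ε d = 0`, so `f₀ d` has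
    -- values in the boundaries.
    (fun n f => ∀ x, T.cplx.diff n (n - 1) (f (P.cplx.diff ((n + 1 : ℕ) : ℤ) n x)) = 0)
    (fun n f g => T.cplx.diff ((n + 1 : ℕ) : ℤ) n ∘ₗ g = f ∘ₗ P.cplx.diff ((n + 1 : ℕ) : ℤ) n)
    f₀ (fun x => by
      obtain ⟨y, hy⟩ := (T.exact_zero (f₀ (P.cplx.diff 1 0 x))).1
        ((LinearMap.congr_fun hf₀ _).trans ((P.exact_zero _).2 ⟨x, rfl⟩))
      exact (congrArg (T.cplx.diff 0 (0 - 1)) hy.symm).trans (T.cplx.diff_diff _ _ _ y))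
    (fun n f h => by
      obtain ⟨g, hg⟩ := exists_lift_of_projective (T.cplx.diff ((n + 1 : ℕ) : ℤ) n)
        (f ∘ₗ P.cplx.diff ((n + 1 : ℕ) : ℤ) n)
        fun x => (T.exact_of_eq (by push_cast; rfl) (sub_add_cancel _ 1) _).1 (h x)
      refine ⟨g, fun x => ?_, hg⟩
      obtain ⟨l, hl⟩ : ∃ l : ℤ, ((n + 1 : ℕ) : ℤ) - 1 = l := ⟨_, rfl⟩
      obtain rfl : l = n := by push_cast at hl; omega
      rw [hl]
      refine (LinearMap.congr_fun hg _).trans ?_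
      rw [LinearMap.comp_apply, P.cplx.diff_diff, map_zero])
  -- The zero maps in negative degrees are mere placeholders: commutation is claimed only when the
  -- lower degree is nonnegative.
  refine ⟨fun n => match n with
    | Int.ofNat m => f m
    | Int.negSucc _ => 0, fun x => LinearMap.congr_fun hf₀ x, ?_⟩
  intro i j hj hi
  obtain ⟨m, rfl⟩ := Int.eq_ofNat_of_zero_le hj
  obtain rfl : i = ((m + 1 : ℕ) : ℤ) := by push_cast; exact hi.symm
  exact hf m

variable {P : ProjRes.{u, u', v} k A} {T : CompleteRes.{u, u', v} k A}

/-- A comparison map is a homotopy equivalence in nonnegative degrees. -/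
theorem Comparison.exists_inverse (ϑ : Comparison T P) :
    ∃ ψ : ∀ n, P.cplx.X n →ₗ[Env k A] T.cplx.X n,
      (∀ i j : ℤ, 0 ≤ j → j + 1 = i → T.cplx.diff i j ∘ₗ ψ i = ψ j ∘ₗ P.cplx.diff i j) ∧
      (∀ i j l : ℤ, 0 ≤ j → j + 1 = i → l + 1 = j →
        ∃ (a : T.cplx.X j →ₗ[Env k A] T.cplx.X i) (b : T.cplx.X l →ₗ[Env k A] T.cplx.X j),
          ψ j ∘ₗ (ϑ.hom.f j).hom = LinearMap.id
            + (T.cplx.diff i j ∘ₗ a + b ∘ₗ T.cplx.diff j l)) ∧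
      (∀ i j l : ℤ, 0 ≤ j → j + 1 = i → l + 1 = j →
        ∃ (a : P.cplx.X j →ₗ[Env k A] P.cplx.X i) (b : P.cplx.X l →ₗ[Env k A] P.cplx.X j),
          (ϑ.hom.f j).hom ∘ₗ ψ j = LinearMap.id
            + (P.cplx.diff i j ∘ₗ a + b ∘ₗ P.cplx.diff j l)) := by
  obtain ⟨ψ, hε, hψ⟩ := exists_lift_to_complete P T
  refine ⟨ψ, hψ, fun i j l hj hi hl => ?_, fun i j l hj hi hl => ?_⟩
  · obtain ⟨a, b, h⟩ := exists_nullhomotopy T.projective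
      (fun i j l _ hi hl x hx => (T.exact_of_eq hi hl x).1 hx)
      (fun n => ψ n ∘ₗ (ϑ.hom.f n).hom - LinearMap.id)
      (fun i j hj hi => by
        rw [LinearMap.comp_sub, LinearMap.sub_comp, ← LinearMap.comp_assoc, hψ i j hj hi,
          LinearMap.comp_assoc, ← BimodComplex.hom_comm, LinearMap.comp_id, LinearMap.id_comp,
          LinearMap.comp_assoc])
      (fun x => (T.exact_zero _).1 (by
        rw [LinearMap.sub_apply, map_sub, LinearMap.comp_apply, hε, ϑ.aug_hom, LinearMap.id_apply,
          sub_self])) i j l hj hi hl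
    exact ⟨a, b, by rw [← h, add_sub_cancel]⟩
  · obtain ⟨a, b, h⟩ := exists_nullhomotopy P.projective
      (fun i j l hj hi hl x hx => (P.exact hj hi hl x).1 hx)
      (fun n => (ϑ.hom.f n).hom ∘ₗ ψ n - LinearMap.id)
      (fun i j hj hi => by
        rw [LinearMap.comp_sub, LinearMap.sub_comp, ← LinearMap.comp_assoc,
          ← BimodComplex.hom_comm, LinearMap.comp_assoc, hψ i j hj hi, LinearMap.comp_id,
          LinearMap.id_comp, LinearMap.comp_assoc])
      (fun x => (P.exact_zero _).1 (by
        rw [LinearMap.sub_apply, map_sub, LinearMap.comp_apply, ϑ.aug_hom, hε, LinearMap.id_apply,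
          sub_self])) i j l hj hi hl
    exact ⟨a, b, by rw [← h, add_sub_cancel]⟩

/-! ### The comparison maps on cohomology and homology. -/

section Vertical

variable (M : Type w) [AddCommGroup M] [Module k M] [Module (Env k A) M]
  [IsScalarTower k (Env k A) M]

/-- A cocycle `f` on `T` pulls back to the cocycle `f ψ` on `P`, and `f ψ ϑ = f + (f b) d` because
`f d = 0`. Only `ψ` in degrees `n + 1` and `n` enters, so degree zero is allowed. -/
theorem Comparison.toTate_surjective (ϑ : Comparison T P) {n : ℤ} (hn : 0 ≤ n) :
    Function.Surjective (ϑ.toTate M n) := by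
  obtain ⟨ψ, hψ, hT, -⟩ := ϑ.exists_inverse
  intro y
  obtain ⟨⟨f, hf⟩, rfl⟩ := Submodule.Quotient.mk_surjective _ y
  have hf' := BimodComplex.mem_cocycles.1 hf
  refine ⟨Submodule.Quotient.mk ⟨f ∘ₗ ψ n, BimodComplex.mem_cocycles.2 ?_⟩, ?_⟩
  · rw [LinearMap.comp_assoc, ← hψ _ _ hn rfl, ← LinearMap.comp_assoc, hf', LinearMap.zero_comp]
  · obtain ⟨a, b, h⟩ := hT (n + 1) n (n - 1) hn rfl (sub_add_cancel n 1)
    refine (Submodule.Quotient.eq _).2 (BimodComplex.mem_coboundaries.2 ⟨f ∘ₗ b, ?_⟩)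
    have e : f ∘ₗ (ψ n ∘ₗ (ϑ.hom.f n).hom) = f + (f ∘ₗ b) ∘ₗ T.cplx.diff n (n - 1) := by
      rw [h, LinearMap.comp_add, LinearMap.comp_add, ← LinearMap.comp_assoc a, hf',
        LinearMap.zero_comp, zero_add, LinearMap.comp_id, LinearMap.comp_assoc]
    exact (sub_eq_of_eq_add' e).symm

/-- Injectivity moves a cochain `g` with `g d = f ϑ` back to `P` as `g ψ`; this needs `ψ` to commute
with `d` from degree `n` to `n - 1`, hence `n - 1 ≥ 0`. -/
theorem Comparison.toTate_bijective (ϑ : Comparison T P) {n : ℤ} (hn : 0 < n) :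
    Function.Bijective (ϑ.toTate M n) := by
  refine ⟨?_, ϑ.toTate_surjective M hn.le⟩
  obtain ⟨ψ, hψ, -, hP⟩ := ϑ.exists_inverse
  rw [injective_iff_map_eq_zero]
  intro y hy
  obtain ⟨⟨f, hf⟩, rfl⟩ := Submodule.Quotient.mk_surjective _ y
  have hf' := BimodComplex.mem_cocycles.1 hf
  have hy' : f ∘ₗ (ϑ.hom.f n).hom ∈ T.cplx.coboundaries M n :=
    (Submodule.Quotient.mk_eq_zero
      ((T.cplx.coboundaries M n).submoduleOf (T.cplx.cocycles M n))).1 hy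
  obtain ⟨g, hg⟩ := BimodComplex.mem_coboundaries.1 hy'
  obtain ⟨a, b, h⟩ := hP (n + 1) n (n - 1) hn.le rfl (sub_add_cancel n 1)
  -- The witness comes from computing `f ϑ ψ` twice: it is `f + f b d` by the homotopy and `g d ψ =
  -- g ψ d` by the choice of `g`.
  refine (Submodule.Quotient.mk_eq_zero _).2 (BimodComplex.mem_coboundaries.2
    ⟨g ∘ₗ ψ (n - 1) - f ∘ₗ b, ?_⟩)
  have e : f ∘ₗ ((ϑ.hom.f n).hom ∘ₗ ψ n) = f + (f ∘ₗ b) ∘ₗ P.cplx.diff n (n - 1) := by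
    rw [h, LinearMap.comp_add, LinearMap.comp_add, ← LinearMap.comp_assoc a, hf',
      LinearMap.zero_comp, zero_add, LinearMap.comp_id, LinearMap.comp_assoc]
  rw [← LinearMap.comp_assoc, ← hg, LinearMap.comp_assoc,
    hψ n (n - 1) (by omega) (sub_add_cancel n 1), ← LinearMap.comp_assoc] at e
  rw [LinearMap.sub_comp, e]
  exact add_sub_cancel_right _ _

theorem mapLeft_id {X : Type*} [AddCommGroup X] [Module k X] [Module (Env k A) X]
    [IsScalarTower k (Env k A) X] (t : TensorEnv k A X M) :
    TensorEnv.mapLeft M (LinearMap.id : X →ₗ[Env k A] X) t = t := by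
  induction t using TensorEnv.induction_on with
  | zero => rw [map_zero]
  | add s t hs ht => rw [map_add, hs, ht]
  | mk x m => rfl

/-- If `ϑ z = d w`, then `d ψ w = ψ ϑ z = z + d a z` for a cycle `z`, so `z` is the boundary of `ψ w
- a z`. Again only the differential from degree `n + 1` to `n` is involved. -/
theorem Comparison.ofTate_injective (ϑ : Comparison T P) {n : ℤ} (hn : 0 ≤ n) :
    Function.Injective (ϑ.ofTate M n) := by
  obtain ⟨ψ, hψ, hT, -⟩ := ϑ.exists_inverse
  rw [injective_iff_map_eq_zero]
  intro y hy
  obtain ⟨⟨z, hz⟩, rfl⟩ := Submodule.Quotient.mk_surjective _ y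
  have hz' := BimodComplex.mem_cycles.1 hz
  obtain ⟨w, hw⟩ := (Submodule.Quotient.mk_eq_zero _).1 hy
  change TensorEnv.mapLeft M _ w = TensorEnv.mapLeft M (ϑ.hom.f n).hom z at hw
  obtain ⟨a, b, h⟩ := hT (n + 1) n (n - 1) hn rfl (sub_add_cancel n 1)
  refine (Submodule.Quotient.mk_eq_zero _).2
    ⟨TensorEnv.mapLeft M (ψ (n + 1)) w - TensorEnv.mapLeft M a z, ?_⟩
  have e := congrArg (TensorEnv.mapLeft M (ψ n)) hw
  rw [mapLeft_mapLeft, mapLeft_mapLeft, h, ← hψ _ _ hn rfl, mapLeft_add, mapLeft_add, mapLeft_id,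
    ← mapLeft_mapLeft, ← mapLeft_mapLeft, ← mapLeft_mapLeft _ b, hz', map_zero, add_zero] at e
  rw [map_sub]
  exact sub_eq_of_eq_add e

/-- A cycle `z` lifts to `ψ z`, since `ϑ ψ z = z + d a z`. That `ψ z` is a cycle uses commutation
from degree `n` to `n - 1`, which is available only for `n > 0`. -/
theorem Comparison.ofTate_bijective (ϑ : Comparison T P) {n : ℤ} (hn : 0 < n) :
    Function.Bijective (ϑ.ofTate M n) := by
  refine ⟨ϑ.ofTate_injective M hn.le, ?_⟩
  obtain ⟨ψ, hψ, -, hP⟩ := ϑ.exists_inverse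
  intro y
  obtain ⟨⟨z, hz⟩, rfl⟩ := Submodule.Quotient.mk_surjective _ y
  have hz' := BimodComplex.mem_cycles.1 hz
  refine ⟨Submodule.Quotient.mk ⟨TensorEnv.mapLeft M (ψ n) z, BimodComplex.mem_cycles.2 ?_⟩, ?_⟩
  · rw [mapLeft_mapLeft, hψ n (n - 1) (by omega) (sub_add_cancel n 1), ← mapLeft_mapLeft, hz',
      map_zero]
  · obtain ⟨a, b, h⟩ := hP (n + 1) n (n - 1) hn.le rfl (sub_add_cancel n 1)
    refine (Submodule.Quotient.eq _).2 ⟨TensorEnv.mapLeft M a z, ?_⟩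
    have e : TensorEnv.mapLeft M (ϑ.hom.f n).hom (TensorEnv.mapLeft M (ψ n) z)
        = z + TensorEnv.mapLeft M (P.cplx.diff (n + 1) n) (TensorEnv.mapLeft M a z) := by
      rw [mapLeft_mapLeft, mapLeft_mapLeft, h, mapLeft_add, mapLeft_add, mapLeft_id,
        ← mapLeft_mapLeft _ b, hz', map_zero, add_zero]
    exact (sub_eq_of_eq_add' e).symm

end Vertical

/-! ### Right linear maps and the right linear contraction of a projective resolution. -/

/-- The element of `A` underlying an element of the regular bimodule. -/
def Regular.val (x : Regular k A) : A := x

section RightLinear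

variable {X : Type*} [AddCommGroup X] [Module k X] [Module (Env k A) X]
  [IsScalarTower k (Env k A) X]
variable {Y : Type*} [AddCommGroup Y] [Module k Y] [Module (Env k A) Y]
  [IsScalarTower k (Env k A) Y]
variable {Z : Type*} [AddCommGroup Z] [Module k Z] [Module (Env k A) Z]
  [IsScalarTower k (Env k A) Z]

variable (A) in
/-- A `k`-linear map of bimodules that is linear for the right action of `A`. -/
def IsRightLinear (f : X →ₗ[k] Y) : Prop :=
  ∀ (b : Aᵐᵒᵖ) (x : X), f (((1 : A) ⊗ₜ[k] b : Env k A) • x) = ((1 : A) ⊗ₜ[k] b : Env k A) • f x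

/-- A right linear map from a projective bimodule lifts to a right linear map along every bimodule
map whose range contains its range. -/
theorem exists_rightLinear_lift [Module.Projective (Env k A) X] (g : Y →ₗ[Env k A] Z)
    (f : X →ₗ[k] Z) (hf : IsRightLinear A f) (h : ∀ x, ∃ y, g y = f x) :
    ∃ l : X →ₗ[k] Y, IsRightLinear A l ∧ ∀ x, g (l x) = f x := by
  obtain ⟨σ, hσ⟩ := Module.Projective.out (R := Env k A) (P := X)
  have hβ : ∀ x : X, ∃ β : A →ₗ[k] Y,
      -- As a right `A`-module, `A ⊗ Aᵒᵖ` is induced from the vector space `A ⊗ 1`. On that space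
      -- only a `k`-linear lift is required, and it exists because `k` is a field.
      ∀ a, g (β a) = f ((a ⊗ₜ[k] (1 : Aᵐᵒᵖ) : Env k A) • x) := fun x => by
    obtain ⟨β, hβ⟩ := exists_lift_of_projective (g.restrictScalars k)
      (f ∘ₗ (LinearMap.toSpanSingleton (Env k A) X x).restrictScalars k ∘ₗ
        (TensorProduct.mk k A Aᵐᵒᵖ).flip 1) (fun a => h _)
    exact ⟨β, fun a => LinearMap.congr_fun hβ a⟩
  choose β hβ using hβ
  -- The right linear extension `a ⊗ b ↦ β(a) b` on the copy of `A ⊗ Aᵒᵖ` indexed by `x`. Their sum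
  -- `L` is defined on a free bimodule, and the section `σ` carries it back to `X`.
  let L₀ : X → (Env k A →ₗ[k] Y) := fun x => TensorProduct.lift
    (LinearMap.mk₂ k (fun a b => ((1 : A) ⊗ₜ[k] b : Env k A) • β x a)
      (fun a a' b => by rw [map_add, smul_add])
      (fun c a b => by rw [map_smul, smul_comm])
      (fun a b b' => by rw [TensorProduct.tmul_add, add_smul])
      (fun c a b => by rw [TensorProduct.tmul_smul, smul_assoc]))
  have hL₀ : ∀ x a b, L₀ x (a ⊗ₜ[k] b) = ((1 : A) ⊗ₜ[k] b : Env k A) • β x a := fun _ _ _ => rfl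
  have hL₁ : ∀ x e, g (L₀ x e) = f (e • x) := fun x e => by
    induction e using TensorProduct.induction_on with
    | zero => rw [map_zero, map_zero, zero_smul, map_zero]
    | add e e' he he' => rw [map_add, map_add, he, he', add_smul, map_add]
    | tmul a b =>
      rw [hL₀, map_smul, hβ, ← hf, ← mul_smul, Algebra.TensorProduct.tmul_mul_tmul, one_mul,
        mul_one]
  have hL₂ : ∀ x (b : Aᵐᵒᵖ) (e : Env k A), L₀ x (((1 : A) ⊗ₜ[k] b : Env k A) * e)
      = ((1 : A) ⊗ₜ[k] b : Env k A) • L₀ x e := fun x b e => by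
    induction e using TensorProduct.induction_on with
    | zero => rw [mul_zero, map_zero, smul_zero]
    | add e e' he he' => rw [mul_add, map_add, he, he', map_add, smul_add]
    | tmul a b' =>
      rw [Algebra.TensorProduct.tmul_mul_tmul, hL₀, hL₀, ← mul_smul,
        Algebra.TensorProduct.tmul_mul_tmul, one_mul, one_mul]
  let L : (X →₀ Env k A) →ₗ[k] Y := Finsupp.lsum k L₀
  have hL : ∀ x e, L (Finsupp.single x e) = L₀ x e := fun x e => Finsupp.lsum_single k L₀ x e
  refine ⟨L ∘ₗ σ.restrictScalars k, fun b x => ?_, fun x => ?_⟩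
  · rw [LinearMap.comp_apply, LinearMap.comp_apply, LinearMap.restrictScalars_apply,
      LinearMap.restrictScalars_apply, map_smul]
    generalize σ x = t
    induction t using Finsupp.induction_linear with
    | zero => rw [smul_zero, map_zero, smul_zero]
    | add s t hs ht => rw [smul_add, map_add, hs, ht, map_add, smul_add]
    | single x e => rw [Finsupp.smul_single, hL, hL, smul_eq_mul, hL₂]
  · have e : ∀ t, g (L t) = f (Finsupp.linearCombination (Env k A) id t) := fun t => by
      induction t using Finsupp.induction_linear with
      | zero => rw [map_zero, map_zero, map_zero, map_zero]
      | add s t hs ht => rw [map_add, map_add, hs, ht, map_add, map_add]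
      | single x e => rw [hL, hL₁, Finsupp.linearCombination_single, id_eq]
    rw [LinearMap.comp_apply, LinearMap.restrictScalars_apply, e, hσ]

/-- The map `s ⊗ id` on `X ⊗_A Z` for a right linear map `s`. -/
def TensorA.mapRightLinear (Z : Type*) [AddCommGroup Z] [Module k Z] [Module (Env k A) Z]
    [IsScalarTower k (Env k A) Z] (s : X →ₗ[k] Y) (hs : IsRightLinear A s) :
    TensorA k A X Z →ₗ[k] TensorA k A Y Z :=
  TensorA.lift (LinearMap.mk₂ k (fun x z => TensorA.mk k A (s x) z)
    (fun x x' z => by rw [map_add, TensorA.mk_add_left])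
    (fun c x z => by rw [map_smul, TensorA.mk_smul_left])
    (fun x z z' => TensorA.mk_add_right _ _ _)
    (fun c x z => TensorA.mk_smul_right _ _ _))
    (fun x a z => by
      rw [LinearMap.mk₂_apply, LinearMap.mk₂_apply, hs, TensorA.mk_balanced])

theorem TensorA.mapRightLinear_mk (s : X →ₗ[k] Y) (hs : IsRightLinear A s) (x : X) (z : Z) :
    TensorA.mapRightLinear Z s hs (TensorA.mk k A x z) = TensorA.mk k A (s x) z := rfl

/-- The map `X ⊗_A Z → Z`, `x ⊗ z ↦ ε x • z`, induced by a bimodule map `ε : X → A`. -/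
def augLeft (Z : Type*) [AddCommGroup Z] [Module k Z] [Module (Env k A) Z]
    [IsScalarTower k (Env k A) Z] (ε : X →ₗ[Env k A] Regular k A) : TensorA k A X Z →ₗ[k] Z :=
  TensorA.lift (LinearMap.mk₂ k (fun x z => leftAct k A Z (ε x).val z)
    (fun x x' z => by
      rw [map_add]
      exact LinearMap.congr_fun (map_add (leftAct k A Z) (ε x).val (ε x').val) z)
    (fun c x z => by
      rw [LinearMap.map_smul_of_tower]
      exact LinearMap.congr_fun (map_smul (leftAct k A Z) c (ε x).val) z)
    (fun x z z' => map_add _ _ _)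
    (fun c x z => map_smul _ _ _))
    (fun x a z => by
      have e : (ε (((1 : A) ⊗ₜ[k] MulOpposite.op a : Env k A) • x)).val = (ε x).val * a := by
        rw [map_smul, Regular.smul_eq]
        exact congrArg (· * a) (one_mul (ε x).val)
      rw [LinearMap.mk₂_apply, LinearMap.mk₂_apply, e]
      exact LinearMap.congr_fun (map_mul (leftAct k A Z) (ε x).val a) z)

theorem augLeft_mk (ε : X →ₗ[Env k A] Regular k A) (x : X) (z : Z) :
    augLeft Z ε (TensorA.mk k A x z) = ((ε x).val ⊗ₜ[k] (1 : Aᵐᵒᵖ) : Env k A) • z := rfl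

/-- With `augLeft_map_left` applied to `f = d`, this says that `ε ⊗ id`, applied to the components
with first degree zero, is a chain map from `P ⊗_A P` to `P`. -/
theorem augLeft_map_right (ε : X →ₗ[Env k A] Regular k A) (f : Y →ₗ[Env k A] Z)
    (t : TensorA k A X Y) :
    augLeft Z ε (TensorA.map LinearMap.id f t) = f (augLeft Y ε t) := by
  induction t using TensorA.induction_on with
  | zero => simp only [map_zero]
  | add s t hs ht => simp only [map_add, hs, ht]
  | mk x y => rw [TensorA.map_mk, augLeft_mk, augLeft_mk, map_smul, LinearMap.id_apply]

theorem augLeft_map_left (ε : Y →ₗ[Env k A] Regular k A) (f : X →ₗ[Env k A] Y)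
    (h : ∀ x, ε (f x) = 0) (t : TensorA k A X Z) :
    augLeft Z ε (TensorA.map f LinearMap.id t) = 0 := by
  induction t using TensorA.induction_on with
  | zero => simp only [map_zero]
  | add s t hs ht => simp only [map_add, hs, ht, add_zero]
  | mk x z =>
    rw [TensorA.map_mk, augLeft_mk, h]
    exact (congrArg (fun e : Env k A => e • z) (TensorProduct.zero_tmul A (1 : Aᵐᵒᵖ))).trans
      (zero_smul _ _)

/-- Factors `ε ⊗ ε'` through `ε ⊗ id`, which turns the augmentation condition on `P ⊗_A P` into one
on `P`. -/
theorem aug_augLeft (ε : X →ₗ[Env k A] Regular k A) (ε' : Y →ₗ[Env k A] Regular k A)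
    (t : TensorA k A X Y) : ε' (augLeft Y ε t) = augTensor ε ε' t := by
  induction t using TensorA.induction_on with
  | zero => simp only [map_zero]
  | add s t hs ht => simp only [map_add, hs, ht]
  | mk x y =>
    rw [augLeft_mk, map_smul, Regular.smul_eq]
    exact mul_one (ε x * ε' y)

end RightLinear

/-- The augmented complex of a projective resolution of `A` has a right linear contraction `s`. -/
theorem ProjRes.exists_contraction (P : ProjRes.{u, u', v} k A) :
    ∃ (p : P.cplx.X 0) (s : ∀ i j : ℤ, P.cplx.X i →ₗ[k] P.cplx.X j),
      (∀ i j, IsRightLinear A (s i j)) ∧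
      (∀ x, P.cplx.diff 1 0 (s 0 1 x)
        = x - ((1 : A) ⊗ₜ[k] MulOpposite.op (P.aug x).val : Env k A) • p) ∧
      ∀ i j l : ℤ, 0 < j → j + 1 = i → l + 1 = j → ∀ x,
        P.cplx.diff i j (s j i x) + s l j (P.cplx.diff j l x) = x := by
  have hproj := P.projective
  obtain ⟨p, hp⟩ := P.aug_surjective (Regular.of k 1)
  -- As `ε p = 1`, the map `a ↦ p a` is a right linear section of `ε`; `f₀` is the complementary
  -- projection onto `ker ε`, which consists of boundaries.
  let f₀ : P.cplx.X 0 →ₗ[k] P.cplx.X 0 := LinearMap.id -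
    { toFun := fun x => ((1 : A) ⊗ₜ[k] MulOpposite.op (P.aug x).val : Env k A) • p
      map_add' := fun x y => by
        rw [map_add, ← add_smul, ← TensorProduct.tmul_add]
        rfl
      map_smul' := fun c x => by
        rw [LinearMap.map_smul_of_tower, RingHom.id_apply, ← smul_assoc,
          ← TensorProduct.tmul_smul]
        rfl }
  have hf₀ : ∀ x, f₀ x
      = x - ((1 : A) ⊗ₜ[k] MulOpposite.op (P.aug x).val : Env k A) • p := fun _ => rfl
  obtain ⟨s₀, hs₀, hs₀'⟩ := exists_rightLinear_lift (P.cplx.diff 1 0) f₀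
    (fun b x => by
      rw [hf₀, hf₀, smul_sub, map_smul, Regular.smul_eq, ← mul_smul,
        Algebra.TensorProduct.tmul_mul_tmul, one_mul]
      congr 4
      exact congrArg (· * b.unop) (one_mul (P.aug x).val))
    (fun x => (P.exact_zero _).1 (by
      rw [hf₀, map_sub, map_smul, hp, Regular.smul_eq, sub_eq_zero]
      exact ((congrArg (· * (P.aug x).val) (one_mul (1 : A))).trans
        (one_mul (P.aug x).val)).symm))
  obtain ⟨f, rfl, hf, hf'⟩ := exists_seq_of_step
    (α := fun n : ℕ => P.cplx.X (n : ℤ) →ₗ[k] P.cplx.X ((n + 1 : ℕ) : ℤ))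
    -- The condition says that `id - f d` has values in cycles one degree up, which is what is
    -- needed to lift it to the next stage of the contraction.
    (fun n f => IsRightLinear A f ∧ ∀ x, P.cplx.diff ((n + 1 : ℕ) : ℤ) n
      (x - f (P.cplx.diff ((n + 1 : ℕ) : ℤ) n x)) = 0)
    (fun n f g => ∀ x, P.cplx.diff ((n + 1 + 1 : ℕ) : ℤ) ((n + 1 : ℕ) : ℤ) (g x)
      = x - f (P.cplx.diff ((n + 1 : ℕ) : ℤ) n x))
    s₀ ⟨hs₀, fun x => by
      rw [map_sub]
      refine sub_eq_zero.2 (Eq.symm ((hs₀' (P.cplx.diff 1 0 x)).trans ?_))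
      have e : P.aug (P.cplx.diff 1 0 x) = 0 := (P.exact_zero _).2 ⟨x, rfl⟩
      have e' : ((1 : A) ⊗ₜ[k] MulOpposite.op (0 : Regular k A).val : Env k A) = 0 :=
        TensorProduct.tmul_zero _ _
      rw [hf₀, e, e', zero_smul]
      exact sub_zero _⟩
    (fun n f h => by
      obtain ⟨g, hg, hg'⟩ := exists_rightLinear_lift
        (P.cplx.diff ((n + 1 + 1 : ℕ) : ℤ) ((n + 1 : ℕ) : ℤ))
        (LinearMap.id - f ∘ₗ (P.cplx.diff ((n + 1 : ℕ) : ℤ) n).restrictScalars k)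
        (fun b x => by
          simp only [LinearMap.sub_apply, LinearMap.comp_apply, LinearMap.id_apply,
            LinearMap.restrictScalars_apply, map_smul]
          rw [h.1, smul_sub])
        (fun x => (P.exact (by push_cast; omega) (by push_cast; rfl) (by push_cast; rfl) _).1
          (h.2 x))
      refine ⟨g, ⟨hg, fun x => ?_⟩, hg'⟩
      rw [map_sub, hg']
      simp only [LinearMap.sub_apply, LinearMap.comp_apply, LinearMap.id_apply,
        LinearMap.restrictScalars_apply]
      rw [P.cplx.diff_diff, map_zero, sub_zero, sub_self])
  -- The contraction is spread over all pairs of integers, with value zero off the pairs `(n, n +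
  -- 1)` with `n ≥ 0`. This lets it be used at any indices without casts.
  have hs : ∀ i j : ℤ, ∃ t : P.cplx.X i →ₗ[k] P.cplx.X j, IsRightLinear A t ∧
      ∀ n : ℕ, i = n → j = ((n + 1 : ℕ) : ℤ) → HEq t (f n) := fun i j => by
    by_cases h : ∃ n : ℕ, i = n ∧ j = ((n + 1 : ℕ) : ℤ)
    · obtain ⟨n, rfl, rfl⟩ := h
      refine ⟨f n, (hf n).1, fun m hm _ => ?_⟩
      obtain rfl : n = m := by exact_mod_cast hm
      rfl
    · exact ⟨0, fun b x => (smul_zero _).symm, fun n h₁ h₂ => (h ⟨n, h₁, h₂⟩).elim⟩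
  choose s hlin hs using hs
  replace hs : ∀ n : ℕ, s n ((n + 1 : ℕ) : ℤ) = f n := fun n => eq_of_heq (hs _ _ n rfl rfl)
  refine ⟨p, s, hlin, fun x => ?_, fun i j l hj hi hl x => ?_⟩
  · exact (congrArg (fun F => P.cplx.diff 1 0 (F x)) (hs 0)).trans (hs₀' x)
  · obtain ⟨n, rfl⟩ := Int.eq_ofNat_of_zero_le (show 0 ≤ l by omega)
    obtain rfl : j = ((n + 1 : ℕ) : ℤ) := by push_cast; exact hl.symm
    obtain rfl : i = ((n + 1 + 1 : ℕ) : ℤ) := by push_cast; push_cast at hi; exact hi.symm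
    rw [hs, hs, hf', sub_add_cancel]

/-! ### The tensor square of a projective resolution is again exact over `A`. -/

theorem TensorA.subsingleton_left {X Y : Type*} [AddCommGroup X] [Module k X] [Module (Env k A) X]
    [IsScalarTower k (Env k A) X] [AddCommGroup Y] [Module k Y] [Module (Env k A) Y]
    [IsScalarTower k (Env k A) Y] (h : Subsingleton X) : Subsingleton (TensorA k A X Y) := by
  refine subsingleton_of_forall_eq 0 fun t => ?_
  induction t using TensorA.induction_on with
  | zero => rfl
  | add s t hs ht => rw [hs, ht, add_zero]
  | mk x y => rw [Subsingleton.elim x 0, TensorA.mk, TensorProduct.zero_tmul, map_zero]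

theorem TensorA.subsingleton_right {X Y : Type*} [AddCommGroup X] [Module k X]
    [Module (Env k A) X] [IsScalarTower k (Env k A) X] [AddCommGroup Y] [Module k Y]
    [Module (Env k A) Y] [IsScalarTower k (Env k A) Y] (h : Subsingleton Y) :
    Subsingleton (TensorA k A X Y) := by
  refine subsingleton_of_forall_eq 0 fun t => ?_
  induction t using TensorA.induction_on with
  | zero => rfl
  | add s t hs ht => rw [hs, ht, add_zero]
  | mk x y => rw [Subsingleton.elim y 0, TensorA.mk, TensorProduct.tmul_zero, map_zero]

set_option maxHeartbeats 800000 in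
/-- A cycle of the tensor square of a projective resolution of `A` is a boundary if its image under
`ε ⊗ id` is one. -/
theorem ProjRes.exists_completeTensorDiff_eq (P : ProjRes.{u, u', v} k A) {m m' l : ℤ}
    (hm' : m + 1 = m') (hl : l + 1 = m) (x : CompleteTensorObj P.cplx P.cplx m)
    (hx : completeTensorDiff P.cplx P.cplx m l x = 0) (w : P.cplx.X m')
    (hw : P.cplx.diff m' m w = augLeft (P.cplx.X m) P.aug (x ⟨(0, m), zero_add m⟩)) :
    ∃ y, completeTensorDiff P.cplx P.cplx m' m y = x := by
  subst hm' hl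
  obtain ⟨p, s, hs, h₀, hpos⟩ := P.exists_contraction
  -- The primitive is `(s ⊗ id) x` plus a correction `p ⊗ w` in bidegree `(0, m + 1)`. The first
  -- part alone misses `x` exactly by `p ⊗ (ε ⊗ id) x_{0,m} = p ⊗ d w`.
  let y₁ : CompleteTensorObj P.cplx P.cplx (l + 1 + 1) := fun pq =>
    TensorA.mapRightLinear (P.cplx.X pq.1.2) (s (pq.1.1 - 1) pq.1.1) (hs _ _)
      (x ⟨(pq.1.1 - 1, pq.1.2), by have := pq.2; simp only; omega⟩)
  let y₂ : CompleteTensorObj P.cplx P.cplx (l + 1 + 1) := fun pq =>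
    TensorA.mk k A (Pi.single (M := fun i : ℤ => P.cplx.X i) 0 p pq.1.1)
      (Pi.single (M := fun i : ℤ => P.cplx.X i) (l + 1 + 1) w pq.1.2)
  have hy₁ : ∀ (i j i' : ℤ) (hi : i + 1 = i') (h : i' + j = l + 1 + 1) (h' : i + j = l + 1),
      y₁ ⟨(i', j), h⟩
        = TensorA.mapRightLinear (P.cplx.X j) (s i i') (hs i i') (x ⟨(i, j), h'⟩) := by
    intro i j i' hi h h'
    obtain rfl : i = i' - 1 := by omega
    rfl
  have hy₂ : ∀ (i j : ℤ) (h : i + j = l + 1 + 1), i ≠ 0 → y₂ ⟨(i, j), h⟩ = 0 := by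
    intro i j h hi
    change TensorA.mk k A (Pi.single (M := fun i : ℤ => P.cplx.X i) 0 p i) _ = 0
    rw [Pi.single_eq_of_ne hi, TensorA.mk, TensorProduct.zero_tmul, map_zero]
  have hy₀ : y₂ ⟨(0, l + 1 + 1), zero_add _⟩ = TensorA.mk k A p w :=
    congrArg₂ (TensorA.mk k A) (Pi.single_eq_same _ _) (Pi.single_eq_same _ _)
  have hcomm : ∀ (i i' j j' : ℤ) (t : TensorA k A (P.cplx.X i) (P.cplx.X j)),
      TensorA.map LinearMap.id (P.cplx.diff j j')
        (TensorA.mapRightLinear (P.cplx.X j) (s i i') (hs i i') t)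
      = TensorA.mapRightLinear (P.cplx.X j') (s i i') (hs i i')
        (TensorA.map LinearMap.id (P.cplx.diff j j') t) := by
    intro i i' j j' t
    induction t using TensorA.induction_on with
    | zero => simp only [map_zero]
    | add s t hs ht => simp only [map_add, hs, ht]
    | mk x y => rfl
  have hsub : ∀ (i j : ℤ) (a b : P.cplx.X i) (c : P.cplx.X j),
      TensorA.mk k A (a - b) c = TensorA.mk k A a c - TensorA.mk k A b c := fun i j a b c => by
    rw [TensorA.mk, TensorProduct.sub_tmul, map_sub]
    rfl
  refine ⟨y₁ + y₂, funext ?_⟩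
  rintro ⟨⟨i, j⟩, hij⟩
  rcases lt_trichotomy i 0 with hi | rfl | hi
  · have := TensorA.subsingleton_left (k := k) (A := A) (Y := P.cplx.X j) (P.zero_of_neg i hi)
    exact Subsingleton.elim _ _
  · obtain rfl : j = l + 1 := by omega
    have key : ∀ t : TensorA k A (P.cplx.X 0) (P.cplx.X (l + 1)),
        TensorA.map (P.cplx.diff 1 0) LinearMap.id
          (TensorA.mapRightLinear (P.cplx.X (l + 1)) (s 0 1) (hs 0 1) t)
        = t - TensorA.mk k A p (augLeft (P.cplx.X (l + 1)) P.aug t) := by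
      intro t
      induction t using TensorA.induction_on with
      | zero => rw [map_zero, map_zero, map_zero, TensorA.mk, TensorProduct.tmul_zero, map_zero,
          sub_zero]
      | add s t hs ht => rw [map_add, map_add, hs, ht, map_add, TensorA.mk_add_right]; abel
      | mk x y =>
        rw [TensorA.mapRightLinear_mk, TensorA.map_mk, h₀, hsub, TensorA.mk_balanced, augLeft_mk]
        rfl
    -- This component is built from `x` in bidegree `(-1, m + 1)`, and `P_{-1} = 0`.
    have hzero : y₁ ⟨(0, l + 1 + 1), zero_add _⟩ = 0 := by
      have := TensorA.subsingleton_left (k := k) (A := A) (Y := P.cplx.X (l + 1 + 1))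
        (P.zero_of_neg (-1) (by omega))
      rw [hy₁ (-1) (l + 1 + 1) 0 (by omega) (by omega) (by omega), Subsingleton.elim (x _) 0,
        map_zero]
    rw [completeTensorDiff_succ, Pi.add_apply, Pi.add_apply, hzero, hy₀,
      hy₁ 0 (l + 1) (0 + 1) rfl (by omega) (by omega), hy₂ _ _ _ (by omega),
      add_zero (TensorA.mapRightLinear _ _ _ _), zero_add (TensorA.mk k A p w), TensorA.map_mk, hw]
    refine (congrArg₂ (· + ·) (key _) (by
      rw [Int.negOnePow_zero, Units.val_one, one_smul, LinearMap.id_apply])).trans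
      (sub_add_cancel _ _)
  · obtain ⟨i, rfl⟩ : ∃ i', i = i' + 1 := ⟨i - 1, by omega⟩
    have key : ∀ t : TensorA k A (P.cplx.X (i + 1)) (P.cplx.X j),
        TensorA.map (P.cplx.diff (i + 1 + 1) (i + 1)) LinearMap.id
          (TensorA.mapRightLinear (P.cplx.X j) (s (i + 1) (i + 1 + 1)) (hs _ _) t)
        + TensorA.mapRightLinear (P.cplx.X j) (s i (i + 1)) (hs _ _)
          (TensorA.map (P.cplx.diff (i + 1) i) LinearMap.id t) = t := by
      intro t
      induction t using TensorA.induction_on with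
      | zero => simp only [map_zero, add_zero]
      | add s t hs ht =>
        simp only [map_add]
        rw [add_add_add_comm, hs, ht]
      | mk x y =>
        rw [TensorA.mapRightLinear_mk, TensorA.map_mk, TensorA.map_mk, TensorA.mapRightLinear_mk,
          LinearMap.id_apply, ← TensorA.mk_add_left, hpos _ _ _ hi rfl rfl]
    have hij' : i + j = l := by simp only at hij; omega
    -- The cycle condition in bidegree `(i, j)` expresses `(id ⊗ d) x_{i,j+1}` through `(d ⊗ id)
    -- x_{i+1,j}`. The sign of the differential in bidegree `(i + 1, j)` is opposite, so the two
    -- terms combine into `d s + s d = id`.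
    have e : completeTensorDiff P.cplx P.cplx (l + 1) l x ⟨(i, j), hij'⟩ = 0 := by
      rw [hx, Pi.zero_apply]
    rw [completeTensorDiff_succ] at e
    replace e := eq_neg_of_add_eq_zero_left e
    have hy : ∀ (i j i' : ℤ) (hi : i + 1 = i') (hi' : 0 < i') (h : i' + j = l + 1 + 1)
        (h' : i + j = l + 1), (y₁ + y₂) ⟨(i', j), h⟩
          = TensorA.mapRightLinear (P.cplx.X j) (s i i') (hs i i') (x ⟨(i, j), h'⟩) := by
      intro i j i' hi hi' h h'
      rw [Pi.add_apply, hy₂ _ _ _ hi'.ne', hy₁ i j i' hi h h']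
      exact add_zero _
    rw [completeTensorDiff_succ, hy (i + 1) j (i + 1 + 1) rfl (by omega) (by omega) (by omega),
      hy i (j + 1) (i + 1) rfl hi (by omega) (by omega), hcomm]
    refine Eq.trans ?_ (key (x ⟨(i + 1, j), hij⟩))
    rw [e, map_neg, map_zsmul, Int.negOnePow_succ, Units.val_neg, neg_smul]

/-- Since `ε ⊗ id` is a chain map, the image of a cycle is a cycle of `P`, hence a boundary in
positive degree; the contraction then bounds the cycle itself. -/
theorem ProjRes.completeTensor_exact (P : ProjRes.{u, u', v} k A) {i j l : ℤ} (hj : 0 < j)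
    (hi : j + 1 = i) (hl : l + 1 = j) (x : (completeTensor P.cplx P.cplx).X j)
    (hx : (completeTensor P.cplx P.cplx).diff j l x = 0) :
    ∃ y, (completeTensor P.cplx P.cplx).diff i j y = x := by
  subst hl
  have ha : ∀ i : ℤ, i = 1 → ∀ x : P.cplx.X i, P.aug (P.cplx.diff i 0 x) = 0 := by
    rintro _ rfl x
    exact (P.exact_zero _).2 ⟨x, rfl⟩
  obtain ⟨w, hw⟩ := (P.exact hj hi rfl (augLeft (P.cplx.X (l + 1)) P.aug
    ((x : CompleteTensorObj P.cplx P.cplx (l + 1)) ⟨(0, l + 1), zero_add _⟩))).1 (by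
      -- Only bidegree `(0, l)` of `d x = 0` is needed: applying `ε ⊗ id` removes the `d ⊗ id` term
      -- because `ε d = 0`, and leaves `d` of the image of `x`.
      have e := completeTensorProj_diff P.cplx P.cplx 0 l l (zero_add l) x
      rw [hx, map_zero, Int.negOnePow_zero, Units.val_one, one_smul] at e
      have e' := congrArg (augLeft (P.cplx.X l) P.aug) e
      rw [map_zero, map_add, augLeft_map_right, augLeft_map_left P.aug (P.cplx.diff (0 + 1) 0)
        (ha (0 + 1) (zero_add 1)), zero_add] at e'
      exact e'.symm)
  exact P.exists_completeTensorDiff_eq hi rfl x hx w hw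

/-- Here `ε` of the image under `ε ⊗ id` is `(ε ⊗ ε) x = 0`, so that image is a boundary by
exactness of `P` at degree zero. The cycle condition is automatic: every bidegree of total degree
`-1` has a negative entry. -/
theorem ProjRes.completeTensor_exact_zero (P : ProjRes.{u, u', v} k A)
    (x : (completeTensor P.cplx P.cplx).X 0)
    (hx : augTensor P.aug P.aug (completeTensorProj P.cplx P.cplx 0 0 0 (add_zero 0) x) = 0) :
    ∃ y, (completeTensor P.cplx P.cplx).diff 1 0 y = x := by
  obtain ⟨w, hw⟩ := (P.exact_zero (augLeft (P.cplx.X 0) P.aug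
    (completeTensorProj P.cplx P.cplx 0 0 0 (add_zero 0) x))).1 (by rw [aug_augLeft, hx])
  refine P.exists_completeTensorDiff_eq (l := -1) (zero_add 1) (by omega) x (funext ?_) w hw
  rintro ⟨⟨i, j⟩, hij⟩
  rcases lt_or_ge i 0 with hi | hi
  · have := TensorA.subsingleton_left (k := k) (A := A) (Y := P.cplx.X j) (P.zero_of_neg i hi)
    exact Subsingleton.elim _ _
  · have := TensorA.subsingleton_right (k := k) (A := A) (X := P.cplx.X i)
      (P.zero_of_neg j (by simp only at hij; omega))
    exact Subsingleton.elim _ _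

/-! ### Uniqueness up to homotopy of the diagonal, and compatibility of the products. -/

/-- The diagonal maps `Δ ϑ` and `(ϑ ⊗ ϑ) Δ̂` from a complete resolution to the tensor square of a
projective resolution are homotopic. -/
theorem Comparison.exists_diagonal_homotopy (ϑ : Comparison T P) (Δ : DiagonalApprox P)
    (Δhat : CompleteDiagonalApprox T) (n : ℤ) :
    ∃ (a : T.cplx.X n →ₗ[Env k A] (completeTensor P.cplx P.cplx).X (n + 1))
      (b : T.cplx.X (n - 1) →ₗ[Env k A] (completeTensor P.cplx P.cplx).X n),
      ∀ (p q : ℤ) (h : p + q = n),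
        (DiagonalComponents.ofOrdinary Δ.hom).comp p q n h ∘ₗ (ϑ.hom.f n).hom
          = TensorA.map (ϑ.hom.f p).hom (ϑ.hom.f q).hom ∘ₗ
              (DiagonalComponents.ofComplete Δhat.hom).comp p q n h
            + (completeTensorProj P.cplx P.cplx p q n h ∘ₗ
                (completeTensor P.cplx P.cplx).diff (n + 1) n ∘ₗ a
              + completeTensorProj P.cplx P.cplx p q n h ∘ₗ b ∘ₗ T.cplx.diff n (n - 1)) := by
  rcases lt_or_ge n 0 with hn | hn
  · refine ⟨0, 0, fun p q h => ?_⟩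
    have : Subsingleton (TensorA k A (P.cplx.X p) (P.cplx.X q)) := by
      rcases lt_or_ge p 0 with hp | hp
      · exact TensorA.subsingleton_left (P.zero_of_neg p hp)
      · exact TensorA.subsingleton_right (P.zero_of_neg q (by omega))
    exact LinearMap.ext fun x => Subsingleton.elim _ _
  -- The difference of the two diagonals, assembled from its components. The complete tensor square
  -- of `P` serves as a common target for the ordinary diagonal and for the image of the complete
  -- one.
  let φ : ∀ n, T.cplx.X n →ₗ[Env k A] (completeTensor P.cplx P.cplx).X n := fun n =>
    LinearMap.pi fun pq : Bidegree n =>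
      (DiagonalComponents.ofOrdinary Δ.hom).comp pq.1.1 pq.1.2 n pq.2 ∘ₗ (ϑ.hom.f n).hom
        - TensorA.map (ϑ.hom.f pq.1.1).hom (ϑ.hom.f pq.1.2).hom ∘ₗ
          (DiagonalComponents.ofComplete Δhat.hom).comp pq.1.1 pq.1.2 n pq.2
  have hφ : ∀ (p q n : ℤ) (h : p + q = n) (x : T.cplx.X n),
      completeTensorProj P.cplx P.cplx p q n h (φ n x)
        = (DiagonalComponents.ofOrdinary Δ.hom).comp p q n h ((ϑ.hom.f n).hom x)
          - TensorA.map (ϑ.hom.f p).hom (ϑ.hom.f q).hom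
            ((DiagonalComponents.ofComplete Δhat.hom).comp p q n h x) := fun _ _ _ _ _ => rfl
  obtain ⟨a, b, hab⟩ := exists_nullhomotopy (Q := completeTensor P.cplx P.cplx) T.projective
    (fun i j l hj hi hl x hx => P.completeTensor_exact hj hi hl x hx) φ
    (fun i j _ hi => by
      subst hi
      refine LinearMap.ext fun x => funext ?_
      rintro ⟨⟨p, q⟩, h⟩
      change completeTensorProj P.cplx P.cplx p q j h
          ((completeTensor P.cplx P.cplx).diff (j + 1) j (φ (j + 1) x))
        = completeTensorProj P.cplx P.cplx p q j h (φ j (T.cplx.diff (j + 1) j x))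
      have e : (ϑ.hom.f j).hom (T.cplx.diff (j + 1) j x)
          = P.cplx.diff (j + 1) j ((ϑ.hom.f (j + 1)).hom x) :=
        LinearMap.congr_fun (BimodComplex.hom_comm ϑ.hom (j + 1) j) x
      rw [completeTensorProj_diff, hφ, hφ, hφ, e, DiagonalComponents.comp_diff,
        DiagonalComponents.comp_diff]
      simp only [map_add, map_sub, map_zsmul, TensorA.map_map, smul_sub, LinearMap.id_comp,
        LinearMap.comp_id, BimodComplex.hom_comm]
      abel)
    (fun x => P.completeTensor_exact_zero _ (by
      rw [hφ, map_sub, sub_eq_zero]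
      -- Both diagonals have the same augmentation `ε_T`: `(ε ⊗ ε) Δ ϑ = ε ϑ = ε_T`, and `(ε ϑ ⊗ ε
      -- ϑ) Δ̂ = (ε_T ⊗ ε_T) Δ̂ = ε_T`.
      refine (Δ.aug_hom _).trans ((ϑ.aug_hom x).trans ((Δhat.aug_hom x).symm.trans ?_))
      change augTensor T.aug T.aug ((DiagonalComponents.ofComplete Δhat.hom).comp 0 0 0 _ x) = _
      generalize (DiagonalComponents.ofComplete Δhat.hom).comp 0 0 0 (add_zero 0) x = t
      induction t using TensorA.induction_on with
      | zero => simp only [map_zero]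
      | add s t hs ht => rw [map_add, hs, ht, map_add, map_add]
      | mk x y =>
        change T.aug x * T.aug y = P.aug ((ϑ.hom.f 0).hom x) * P.aug ((ϑ.hom.f 0).hom y)
        rw [ϑ.aug_hom, ϑ.aug_hom]))
    (n + 1) n (n - 1) hn rfl (sub_add_cancel n 1)
  refine ⟨a, b, fun p q h => LinearMap.ext fun x => ?_⟩
  have e := congrArg (completeTensorProj P.cplx P.cplx p q n h) (LinearMap.congr_fun hab x)
  rw [hφ, sub_eq_iff_eq_add', LinearMap.add_apply, map_add] at e
  exact e

section Products

variable (ϑ : Comparison T P) (Δ : DiagonalApprox P) (Δhat : CompleteDiagonalApprox T)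
variable {M : Type w} [AddCommGroup M] [Module k M] [Module (Env k A) M]
  [IsScalarTower k (Env k A) M]
variable {N : Type w'} [AddCommGroup N] [Module k N] [Module (Env k A) N]
  [IsScalarTower k (Env k A) N]

/-- The map from ordinary to Tate cohomology preserves cup products. -/
theorem Comparison.toTate_cup {r s n : ℤ} (h : r + s = n) (u : HochschildCohomology P M r)
    (v : HochschildCohomology P N s) :
    ϑ.toTate (TensorA k A M N) n (hochschildCup Δ h u v)
      = tateCup Δhat h (ϑ.toTate M r u) (ϑ.toTate N s v) := by
  obtain ⟨⟨f, hf⟩, rfl⟩ := Submodule.Quotient.mk_surjective _ u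
  obtain ⟨⟨g, hg⟩, rfl⟩ := Submodule.Quotient.mk_surjective _ v
  have hf' := BimodComplex.mem_cocycles.1 hf
  have hg' := BimodComplex.mem_cocycles.1 hg
  obtain ⟨a, b, hab⟩ := ϑ.exists_diagonal_homotopy Δ Δhat n
  -- The two cup products differ by `(-1)^{rs} (f ⊗ g)(d a + b d)`. The `d a` term vanishes because
  -- `f` and `g` are cocycles, so `(-1)^{rs} (f ⊗ g) b` is a primitive.
  refine (Submodule.Quotient.eq _).2 (BimodComplex.mem_coboundaries.2
    ⟨((r * s).negOnePow : ℤ) • (TensorA.map f g ∘ₗ completeTensorProj P.cplx P.cplx r s n h ∘ₗ b),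
      ?_⟩)
  refine LinearMap.ext fun x => ?_
  have e := congrArg (TensorA.map f g) (LinearMap.congr_fun (hab r s h) x)
  have e₀ : TensorA.map f g (completeTensorProj P.cplx P.cplx r s n h
      ((completeTensor P.cplx P.cplx).diff (n + 1) n (a x))) = 0 := by
    rw [completeTensorProj_diff, map_add, map_zsmul, TensorA.map_map, TensorA.map_map, hf', hg',
      TensorA.map_zero_left, TensorA.map_zero_right, smul_zero, add_zero]
  simp only [LinearMap.comp_apply, LinearMap.add_apply, map_add] at e
  rw [e₀, zero_add, TensorA.map_map] at e
  change ((r * s).negOnePow : ℤ) • TensorA.map f g (completeTensorProj P.cplx P.cplx r s n h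
      (b (T.cplx.diff n (n - 1) x)))
    = ((r * s).negOnePow : ℤ) • TensorA.map f g
        ((DiagonalComponents.ofOrdinary Δ.hom).comp r s n h ((ϑ.hom.f n).hom x))
      - ((r * s).negOnePow : ℤ) • TensorA.map (f ∘ₗ (ϑ.hom.f r).hom) (g ∘ₗ (ϑ.hom.f s).hom)
        ((DiagonalComponents.ofComplete Δhat.hom).comp r s n h x)
  rw [e, ← smul_sub, add_sub_cancel_left]

/-- Naturality of the contraction in the form needed below, where the tensor map appears composed
with a component of a diagonal or of the homotopy. -/
theorem contract_mapLeft_comp {W X X₁ Y Y₁ : Type*} [AddCommGroup W] [Module k W]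
    [Module (Env k A) W] [IsScalarTower k (Env k A) W] [AddCommGroup X] [Module k X]
    [Module (Env k A) X] [IsScalarTower k (Env k A) X] [AddCommGroup X₁] [Module k X₁]
    [Module (Env k A) X₁] [IsScalarTower k (Env k A) X₁] [AddCommGroup Y] [Module k Y]
    [Module (Env k A) Y] [IsScalarTower k (Env k A) Y] [AddCommGroup Y₁] [Module k Y₁]
    [Module (Env k A) Y₁] [IsScalarTower k (Env k A) Y₁] (f : X →ₗ[Env k A] X₁)
    (g : Y →ₗ[Env k A] Y₁) (u : Y₁ →ₗ[Env k A] M) (c : W →ₗ[Env k A] TensorA k A X Y)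
    (z : TensorEnv k A W N) :
    contract X₁ N u (TensorEnv.mapLeft N (TensorA.map f g ∘ₗ c) z)
      = TensorEnv.mapLeft (TensorA k A M N) f
        (contract X N (u ∘ₗ g) (TensorEnv.mapLeft N c z)) := by
  rw [← mapLeft_mapLeft, contract_mapLeft]

/-- The maps between ordinary and Tate (co)homology are compatible with cap products. -/
theorem Comparison.ofTate_cap {t r s : ℤ} (h : t + r = s) (u : HochschildCohomology P M r)
    (z : TateHomology T N s) :
    ϑ.ofTate (TensorA k A M N) t (tateCap Δhat h (ϑ.toTate M r u) z)
      = hochschildCap Δ h u (ϑ.ofTate N s z) := by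
  obtain ⟨⟨f, hf⟩, rfl⟩ := Submodule.Quotient.mk_surjective _ u
  obtain ⟨⟨z, hz⟩, rfl⟩ := Submodule.Quotient.mk_surjective _ z
  have hf' := BimodComplex.mem_cocycles.1 hf
  have hz' := BimodComplex.mem_cycles.1 hz
  obtain ⟨a, b, hab⟩ := ϑ.exists_diagonal_homotopy Δ Δhat s
  -- Contraction of the `(t + 1, r)` component of `a z` with `f`. The `(t, r + 1)` component also
  -- occurs in `d a z`, but there `f` is applied after `d` and gives zero.
  let a' : TensorEnv k A (P.cplx.X (t + 1)) (TensorA k A M N) :=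
    contract (P.cplx.X (t + 1)) N f (TensorEnv.mapLeft N
      (completeTensorProj P.cplx P.cplx (t + 1) r (s + 1) (by omega) ∘ₗ a) z)
  have e := congrArg (contract (P.cplx.X t) N f)
    (congrArg (fun F => TensorEnv.mapLeft N F z) (hab t r h))
  have e₀ : completeTensorProj P.cplx P.cplx t r s h ∘ₗ
        (completeTensor P.cplx P.cplx).diff (s + 1) s ∘ₗ a
      = TensorA.map (P.cplx.diff (t + 1) t) LinearMap.id ∘ₗ
          (completeTensorProj P.cplx P.cplx (t + 1) r (s + 1) (by omega) ∘ₗ a)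
        + (t.negOnePow : ℤ) • (TensorA.map LinearMap.id (P.cplx.diff (r + 1) r) ∘ₗ
          (completeTensorProj P.cplx P.cplx t (r + 1) (s + 1) (by omega) ∘ₗ a)) :=
    LinearMap.ext fun x => completeTensorProj_diff P.cplx P.cplx t r s h (a x)
  have e₁ : contract (P.cplx.X t) N f (TensorEnv.mapLeft N
      (completeTensorProj P.cplx P.cplx t r s h ∘ₗ
        (completeTensor P.cplx P.cplx).diff (s + 1) s ∘ₗ a) z)
      = TensorEnv.mapLeft (TensorA k A M N) (P.cplx.diff (t + 1) t) a' := by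
    rw [e₀, mapLeft_add, mapLeft_zsmul, map_add, map_zsmul, contract_mapLeft_comp,
      contract_mapLeft_comp, hf', contract_zero, map_zero, smul_zero, add_zero,
      LinearMap.comp_id]
  simp only [mapLeft_add, map_add] at e
  -- The `b d` part of the homotopy dies because `z` is a cycle.
  have e₂ : TensorEnv.mapLeft N (completeTensorProj P.cplx P.cplx t r s h ∘ₗ b ∘ₗ
      T.cplx.diff s (s - 1)) z = 0 :=
    (mapLeft_mapLeft _ (completeTensorProj P.cplx P.cplx t r s h ∘ₗ b) z).symm.trans (by
      rw [hz', map_zero])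
  rw [e₁, e₂, map_zero, add_zero, ← mapLeft_mapLeft, contract_mapLeft_comp] at e
  -- Both caps carry the same sign `(-1)^{rt}`. The minus sign arises because the ordinary cap
  -- exceeds the Tate one by `d a'`, while the difference taken here is Tate minus ordinary.
  refine (Submodule.Quotient.eq _).2 ⟨-(((r * t).negOnePow : ℤ) • a'), ?_⟩
  rw [BimodComplex.tensorDiff, map_neg, map_zsmul]
  change _ = TensorEnv.mapLeft (TensorA k A M N) (ϑ.hom.f t).hom (((r * t).negOnePow : ℤ) •
      contract (T.cplx.X t) N (f ∘ₗ (ϑ.hom.f r).hom)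
        (TensorEnv.mapLeft N ((DiagonalComponents.ofComplete Δhat.hom).comp t r s h) z))
    - ((r * t).negOnePow : ℤ) • contract (P.cplx.X t) N f
        (TensorEnv.mapLeft N ((DiagonalComponents.ofOrdinary Δ.hom).comp t r s h)
          (TensorEnv.mapLeft N (ϑ.hom.f s).hom z))
  rw [e, map_zsmul, ← smul_sub, ← smul_neg, sub_add_cancel_left]

end Products

end TateHochschild

end

/-! ### The comparison theorem. -/

theorem proposition4p5 {k A : Type*} [Field k] [Ring A] [Algebra k A]
    (_hA : TateHochschild.IsFrobenius k A)
    {T : TateHochschild.CompleteRes k A} {P : TateHochschild.ProjRes k A}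
    (ϑ : TateHochschild.Comparison T P)
    (Δ : TateHochschild.DiagonalApprox P) (Δhat : TateHochschild.CompleteDiagonalApprox T)
    (M : Type*) [AddCommGroup M] [Module k M] [Module (TateHochschild.Env k A) M]
    [IsScalarTower k (TateHochschild.Env k A) M]
    (N : Type*) [AddCommGroup N] [Module k N] [Module (TateHochschild.Env k A) N]
    [IsScalarTower k (TateHochschild.Env k A) N] :
    -- the vertical morphisms
    (Function.Surjective (ϑ.toTate M 0) ∧
      (∀ n : ℤ, 0 < n → Function.Bijective (ϑ.toTate M n)) ∧
      Function.Injective (ϑ.ofTate N 0) ∧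
      Function.Injective (ϑ.ofTate (TateHochschild.TensorA k A M N) 0) ∧
      (∀ n : ℤ, 0 < n → Function.Bijective (ϑ.ofTate N n)) ∧
      (∀ n : ℤ, 0 < n → Function.Bijective (ϑ.ofTate (TateHochschild.TensorA k A M N) n))) ∧
    -- (1) the cup products, in all degrees
    (∀ (r s : ℤ) (u : TateHochschild.HochschildCohomology P M r)
        (v : TateHochschild.HochschildCohomology P N s),
      ϑ.toTate (TateHochschild.TensorA k A M N) (r + s)
          (TateHochschild.hochschildCup Δ (Eq.refl (r + s)) u v)
        = TateHochschild.tateCup Δhat (Eq.refl (r + s)) (ϑ.toTate M r u) (ϑ.toTate N s v)) ∧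
    -- (2a) the case r = s = 0: the ordinary cap product preserves the subspaces `Ĥ_0 ≤ H_0`,
    -- and its restriction is the Tate cap product
    (∀ (u : TateHochschild.HochschildCohomology P M 0) (z : TateHochschild.TateHomology T N 0),
      TateHochschild.hochschildCap Δ (add_zero (0 : ℤ)) u (ϑ.ofTate N 0 z)
          ∈ LinearMap.range (ϑ.ofTate (TateHochschild.TensorA k A M N) 0) ∧
      ϑ.ofTate (TateHochschild.TensorA k A M N) 0
          (TateHochschild.tateCap Δhat (add_zero (0 : ℤ)) (ϑ.toTate M 0 u) z)
        = TateHochschild.hochschildCap Δ (add_zero (0 : ℤ)) u (ϑ.ofTate N 0 z)) ∧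
    -- (2b) the case r = 0, s > 0
    (∀ s : ℤ, 0 < s → ∀ (u : TateHochschild.HochschildCohomology P M 0)
        (z : TateHochschild.TateHomology T N s),
      ϑ.ofTate (TateHochschild.TensorA k A M N) s
          (TateHochschild.tateCap Δhat (add_zero s) (ϑ.toTate M 0 u) z)
        = TateHochschild.hochschildCap Δ (add_zero s) u (ϑ.ofTate N s z)) ∧
    -- (2c) the case s ≥ r > 0
    (∀ r s : ℤ, 0 < r → r ≤ s → ∀ (u : TateHochschild.HochschildCohomology P M r)
        (z : TateHochschild.TateHomology T N s),
      ϑ.ofTate (TateHochschild.TensorA k A M N) (s - r)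
          (TateHochschild.tateCap Δhat (sub_add_cancel s r) (ϑ.toTate M r u) z)
        = TateHochschild.hochschildCap Δ (sub_add_cancel s r) u (ϑ.ofTate N s z)) := by
  refine ⟨⟨ϑ.toTate_surjective M le_rfl, fun n hn => ϑ.toTate_bijective M hn,
    ϑ.ofTate_injective N le_rfl, ϑ.ofTate_injective _ le_rfl,
    fun n hn => ϑ.ofTate_bijective N hn, fun n hn => ϑ.ofTate_bijective _ hn⟩,
    fun r s u v => ϑ.toTate_cup Δ Δhat _ u v, fun u z => ?_,
    fun s _ u z => ϑ.ofTate_cap Δ Δhat _ u z, fun r s _ _ u z => ϑ.ofTate_cap Δ Δhat _ u z⟩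
  have e := ϑ.ofTate_cap Δ Δhat (add_zero (0 : ℤ)) u z
  -- The identity itself gives the membership: the Tate cap product is the preimage.
  exact ⟨⟨_, e⟩, e⟩
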